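/- **Conventions.** Let $A$ be a nonzero ring and $R\subseteq A$ a subring such that $A$ is a skew PBW extension of $R$ in $x_1,\dots,x_n$: the standard monomials $x^\alpha=x_1^{\alpha_1}\cdots x_n^{\alpha_n}$, $\alpha\in\mathbb N^n$, form a basis of the left $R$-module $A$; for all $i$ and $0\ne r\in R$ there is $0\neq c_{i,r}\in R$ with $x_ir-c_{i,r}x_i\in R$; and for all $i,j$ there is $0\ne c_{i,j}\in R$ with $x_jx_i-c_{i,j}x_ix_j\in R+Rx_1+\cdots+Rx_n$. Assume that the extension is bijective: the maps $\sigma_i:R\to R$ ($\sigma_i(r)=c_{i,r}$ for $r\neq0$, $\sigma_i(0)=0$) are bijective and $c_{i,j}$ is invertible for $i<j$. Assume that $R$ is left Gröbner soluble (LGS): $R$ is left Noetherian, and we are given a procedure that decides for $a,v_1,\dots,v_t\in R$ whether $a\in Rv_1+\cdots+Rv_t$ and, if so, returns $b_1,\dots,b_t$ with $a=\sum b_jv_j$, and a procedure that returns a finite generating set of the left module $\{b\in R^t:\sum b_jv_j=0\}$. Fix a monomial order on the monomials $x^\alpha e_i$ of $A^s$ (a total order, compatible with multiplication, in which multiples of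 a monomial are not smaller than it, and compatible with the total degree $|\alpha|$). Let $\mathrm{lm}$ denote leading monomials and $\mathrm{lc}$ leading coefficients. A nonzero $f\in A^s$ is *reducible* by $g_1,\dots,g_t\in A^s\setminus\{0\}$ if $\mathrm{lc}(f)$ is a left $R$-linear combination of the elements $\mathrm{lc}(x^{\gamma_j}g_j)$, where $j$ runs over the indices with $\mathrm{lm}(g_j)\mid\mathrm{lm}(f)$ and $\mathrm{lm}(x^{\gamma_j}g_j)=\mathrm{lm}(f)$. Finitely many nonzero vectors $g_1,\dots,g_t$ of a left submodule $M\subseteq A^s$ form a *Gröbner basis* of $M$ if every nonzero $f\in M$ is reducible by them. The *division algorithm* starts with $h=f$, zero quotients and zero remainder. While $h\ne0$: if $h$ is reducible, with $\mathrm{lc}(h)=\sum b_j\,\mathrm{lc}(x^{\gamma_j}g_j)$, it subtracts $\sum b_jx^{\gamma_j}g_j$ from $h$ and adds $b_jx^{\gamma_j}$ to the $j$-th quotient; otherwise it moves the leading term of $h$ to the remainder. *Buchberger's algorithm* starts with the given nonzero vectors, and repeatedly divides by the present list all S-vectors $\sum_j b_jx^{\gamma_j}g_j$ (one for each least common multiple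 $X$ of the leading monomials of a nonempty subfamily lying over one canonical vector, and each generator $b$ of the syzygies of the elements $\mathrm{lc}(x^{\gamma_j}g_j)$, over all $j$ with $\mathrm{lm}(g_j)\mid X$, where $\mathrm{lm}(x^{\gamma_j}g_j)=X$) and appends the nonzero remainders, until all remainders are zero. It keeps track of how the vectors are expressed through the given ones. **Algorithm.** Input: $F\in M_{r\times s}(A)$, $r,s\ge 0$. If $r<s$, return "$0$" (a symbol for "there is no left inverse"). If $r\geq s$, take a Gröbner basis $g_1,\dots,g_t$ of the left submodule $\langle F\rangle\subseteq A^s$ generated by the rows of $F$, and $H\in M_{r\times t}(A)$ with $G^T=H^TF$, where $G$ is the matrix with columns $g_1,\dots,g_t$. Divide each canonical vector $e_i$ by $g_1,\dots,g_t$. If some remainder is nonzero, return "$0$". Otherwise $e_i=\sum_j k_{ji}g_j$ with the quotients $k_{ji}$; let $K=[k_{ji}]\in M_{t\times s}(A)$ and return $L:=K^TH^T$. **Statement.** Let $F\in M_{r\times s}(A)$. 1. For every Gröbner basis $g_1,\dots,g_t$ of $\langle F\rangle$ and every $H$ with $G^T=H^TF$: the division of any $f\in A^s$ by $g_1,\dots,g_t$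 ends after finitely many steps, with $f=\sum q_jg_j+\rho$, where $\rho=0$ if and only if $f\in\langle F\rangle$. The algorithm with this $G$ and $H$ ends after finitely many steps. It returns "$0$" if $r<s$; it returns "$0$" if and only if some $e_i\notin\langle F\rangle$, and if and only if $F$ has no left inverse. Otherwise it returns a matrix $L=K^TH^T$ with $K^TG^T=I_s$ and $LF=I_s$. 2. Buchberger's algorithm applied to the rows of $F$ ends after finitely many steps and returns a Gröbner basis of $\langle F\rangle$ and a matrix $H$ with $G^T=H^TF$. 3. Hence the algorithm, with $G$ and $H$ computed by Buchberger's algorithm, ends after finitely many steps. It returns "$0$" if $r<s$, it returns "$0$" if and only if $F$ has no left inverse, and otherwise it returns $L\in M_{s\times r}(A)$ with $LF=I_s$. -/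

import Mathlib

/-! ### Skew PBW extensions -/

/-- The standard monomial `x₁ ^ α₁ ⋯ xₙ ^ αₙ`. -/
def stdMonomial {A : Type*} [Ring A] {n : ℕ} (x : Fin n → A) (α : Fin n → ℕ) : A :=
  (List.ofFn fun i => x i ^ α i).prod

/-- `A` is a skew PBW extension of its subring `R` in the variables `x 0, …, x (n - 1)`. The free
left `R`-module basis of standard monomials is given by linear independence together with the map
`coord` that returns the coordinates of an element of `A`, so that programs can use them. -/
structure SkewPBW {A : Type*} [Ring A] (R : Subring A) (n : ℕ) where
  /-- the variables -/
  x : Fin n → A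
  /-- the standard monomials are linearly independent in the left `R`-module `A` -/
  linearIndependent : LinearIndependent R (stdMonomial x)
  /-- the coefficients of an element of `A` with respect to the standard monomials -/
  coord : A → (Fin n → ℕ) →₀ R
  /-- the standard monomials span the left `R`-module `A` -/
  sum_coord : ∀ a : A, ∑ α ∈ (coord a).support, (coord a α : A) * stdMonomial x α = a
  /-- `xᵢ r - c xᵢ ∈ R` for some nonzero `c ∈ R` -/
  comm_coeff : ∀ (i : Fin n) (r : R), r ≠ 0 →
    ∃ c : R, c ≠ 0 ∧ x i * (r : A) - (c : A) * x i ∈ R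
  /-- `xⱼ xᵢ - c xᵢ xⱼ ∈ R + R x₁ + ⋯ + R xₙ` for some nonzero `c ∈ R` -/
  comm_var : ∀ i j : Fin n,
    ∃ c : R, c ≠ 0 ∧ x j * x i - (c : A) * (x i * x j) ∈ Submodule.span R ({1} ∪ Set.range x)

namespace SkewPBW

variable {A : Type*} [Ring A] {R : Subring A} {n : ℕ}

/-- The map `σᵢ : R → R` with `xᵢ r = σᵢ(r) xᵢ + δᵢ(r)`, `δᵢ(r) ∈ R`: the value `σᵢ(r)` is the
coefficient of `xᵢ` in `xᵢ r`. -/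
def sigma (E : SkewPBW R n) (i : Fin n) (r : R) : R :=
  E.coord (E.x i * (r : A)) (Pi.single i 1)

/-- The constant `c_{i,j}`, `i < j`, with `xⱼ xᵢ - c_{i,j} xᵢ xⱼ ∈ R + R x₁ + ⋯ + R xₙ`: it is the
coefficient of the standard monomial `xᵢ xⱼ` in `xⱼ xᵢ`. -/
def varConst (E : SkewPBW R n) (i j : Fin n) : R :=
  E.coord (E.x j * E.x i) (Pi.single i 1 + Pi.single j 1)

/-- The extension is bijective: every `σᵢ` is bijective and every `c_{i,j}`, `i < j`, is
invertible in `R`. -/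
def IsBijective (E : SkewPBW R n) : Prop :=
  (∀ i, Function.Bijective (E.sigma i)) ∧ ∀ i j, i < j → IsUnit (E.varConst i j)

end SkewPBW

/-! ### Left Gröbner soluble rings -/

/-- `R` is left Gröbner soluble: it is left Noetherian, there is a procedure `solve` which decides
whether a given `a` lies in the left ideal `R v₁ + ⋯ + R vₜ` and, if so, returns coefficients, and
there is a procedure `syz` which returns finitely many generators of the left module of syzygies
of `v₁, …, vₜ`. -/
structure LeftGroebnerSoluble (R : Type*) [Ring R] where
  noetherian : IsNoetherianRing R
  solve : {t : ℕ} → R → (Fin t → R) → Option (Fin t → R)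
  solve_some : ∀ {t : ℕ} (a : R) (v b : Fin t → R), solve a v = some b → a = ∑ j, b j * v j
  solve_none : ∀ {t : ℕ} (a : R) (v : Fin t → R), solve a v = none →
    ∀ b : Fin t → R, a ≠ ∑ j, b j * v j
  syz : {t : ℕ} → (Fin t → R) → List (Fin t → R)
  syz_spec : ∀ {t : ℕ} (v b : Fin t → R),
    b ∈ Submodule.span R {d | d ∈ syz v} ↔ ∑ j, b j * v j = 0

/-! ### Monomials of `A ^ m` and monomial orders -/

/-- The monomial `x ^ exp • e_idx` of `A ^ m`. -/
@[ext] structure VMon (n m : ℕ) where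
  exp : Fin n → ℕ
  idx : Fin m

/-- The leading monomial of `x ^ γ • X`. -/
def VMon.shift {n m : ℕ} (γ : Fin n → ℕ) (X : VMon n m) : VMon n m := ⟨γ + X.exp, X.idx⟩

/-- `X` divides `Y`: both are multiples of the same canonical vector, and the exponent of `Y`
is at least that of `X` in every variable. -/
def VMon.Divides {n m : ℕ} (X Y : VMon n m) : Prop := X.idx = Y.idx ∧ ∀ i, X.exp i ≤ Y.exp i

instance {n m : ℕ} (X Y : VMon n m) : Decidable (X.Divides Y) :=
  inferInstanceAs (Decidable (_ ∧ _))

/-- The least common multiple of a list of monomials, if the list is not empty and all its members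
are multiples of the same canonical vector. -/
def VMon.lcm? {n m : ℕ} : List (VMon n m) → Option (VMon n m)
  | [] => none
  | X :: l =>
    if ∀ Y ∈ l, Y.idx = X.idx then
      some ⟨fun i => l.foldr (fun Y a => max (Y.exp i) a) (X.exp i), X.idx⟩
    else none

/-- A total order on the monomials of `A ^ m` is a monomial order: it is compatible with
multiplication, a multiple of a monomial is not smaller than it, and the order is compatible with
the total degree. -/
structure IsMonomialOrder (n m : ℕ) [LinearOrder (VMon n m)] : Prop where
  shift_le : ∀ (γ : Fin n → ℕ) (X Y : VMon n m), X ≤ Y → X.shift γ ≤ Y.shift γ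
  le_shift : ∀ (γ : Fin n → ℕ) (X : VMon n m), X ≤ X.shift γ
  lt_of_degree_lt : ∀ X Y : VMon n m, ∑ i, X.exp i < ∑ i, Y.exp i → X < Y

/-! ### Leading terms, reduction, Gröbner bases -/

namespace SkewPBW

variable {A : Type*} [Ring A] {R : Subring A} {n m t : ℕ}

/-- The coefficient of the monomial `X` in the vector `f`. -/
def coeff (E : SkewPBW R n) (f : Fin m → A) (X : VMon n m) : R := E.coord (f X.idx) X.exp

/-- The finite set of the monomials that occur in the vector `f`. -/
def monomials [LinearOrder (VMon n m)] (E : SkewPBW R n) (f : Fin m → A) : Finset (VMon n m) :=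
  Finset.univ.biUnion fun i => (E.coord (f i)).support.image fun α => ⟨α, i⟩

/-- The leading monomial of `f` (there is none if `f = 0`). -/
def lm? [LinearOrder (VMon n m)] (E : SkewPBW R n) (f : Fin m → A) : Option (VMon n m) :=
  if h : (E.monomials f).Nonempty then some ((E.monomials f).max' h) else none

/-- The standard monomial `x ^ γ` of `A` such that `x ^ γ • f` has leading monomial `X`, if the
leading monomial of `f` divides `X`; otherwise `0`. -/
def cofactor [LinearOrder (VMon n m)] (E : SkewPBW R n) (X : VMon n m) (f : Fin m → A) : A :=
  match E.lm? f with
  | some Y => if Y.Divides X then stdMonomial E.x fun i => X.exp i - Y.exp i else 0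
  | none => 0

/-- The coefficient at `X` of `cofactor X f • f`: it is the leading coefficient
of `x ^ γ • f` if the leading monomial of `f` divides `X`, and otherwise `0`. -/
def cofactorCoeff [LinearOrder (VMon n m)] (E : SkewPBW R n) (X : VMon n m) (f : Fin m → A) : R :=
  E.coeff (E.cofactor X f • f) X

/-- A nonzero vector `f` is reducible with respect to `G`: its leading coefficient is a left linear
combination of the leading coefficients of the vectors `x ^ γ • G j` that have the
leading monomial of `f` (where `j` runs over the indices for which `lm (G j)` divides `lm f`). -/
def Reducible [LinearOrder (VMon n m)] (E : SkewPBW R n) (G : Fin t → Fin m → A)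
    (f : Fin m → A) : Prop :=
  ∃ X, E.lm? f = some X ∧ ∃ b : Fin t → R, E.coeff f X = ∑ j, b j * E.cofactorCoeff X (G j)

/-- The vectors `G j` form a (finite) Gröbner basis of the left submodule `M` of `A ^ m`. -/
def IsGroebnerBasis [LinearOrder (VMon n m)] (E : SkewPBW R n) (G : Fin t → Fin m → A)
    (M : Submodule A (Fin m → A)) : Prop :=
  (∀ j, G j ∈ M ∧ G j ≠ 0) ∧ ∀ f ∈ M, f ≠ 0 → E.Reducible G f

end SkewPBW

/-! ### Programs

The programs below are executable. Their basic operations are the ring operations of `A` and `R`,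
reading the coordinates of an element of `A`, comparing monomials, and the two procedures
of a left Gröbner soluble ring. Loops that need not end are run by `PFun.fix`, so a
program returns a `Part`, and `p.Dom` says that the run of `p` ends after finitely many steps. -/

/-- Run finitely many programs and collect what they return. -/
def runAll {k : ℕ} {β : Type*} (p : Fin k → Part β) : Part (Fin k → β) :=
  ⟨∀ i, (p i).Dom, fun h i => (p i).get (h i)⟩

namespace SkewPBW

variable {A : Type*} [Ring A] {R : Subring A} {n r s m t : ℕ}

/-- The state of the division algorithm: the vector `h` still to be divided, the quotients
and the remainder. -/
@[ext] structure DivState (A : Type*) (m t : ℕ) where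
  h : Fin m → A
  quot : Fin t → A
  rem : Fin m → A

/-- One pass of the loop of the division algorithm. It ends when `h = 0`. If the leading term of
`h` can be cancelled by a combination `∑ bⱼ x ^ γⱼ • G j`, the combination is
subtracted from `h`; otherwise the leading term is moved to the remainder. -/
def divStep [LinearOrder (VMon n m)] (E : SkewPBW R n) (lgs : LeftGroebnerSoluble R)
    (G : Fin t → Fin m → A) (S : DivState A m t) :
    Part (((Fin t → A) × (Fin m → A)) ⊕ DivState A m t) :=
  match E.lm? S.h with
  | none => Part.some (Sum.inl (S.quot, S.rem))
  | some X =>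
    match lgs.solve (E.coeff S.h X) (fun j => E.cofactorCoeff X (G j)) with
    | some b =>
      let q : Fin t → A := fun j => (b j : A) * E.cofactor X (G j)
      Part.some (Sum.inr
        { h := S.h - ∑ j, q j • G j
          quot := S.quot + q
          rem := S.rem })
    | none =>
      let lt : Fin m → A := Pi.single X.idx ((E.coeff S.h X : A) * stdMonomial E.x X.exp)
      Part.some (Sum.inr { h := S.h - lt, quot := S.quot, rem := S.rem + lt })

/-- The division algorithm: it returns the quotients and the remainder of the division of `f` by
the vectors `G j`. -/
def divide [LinearOrder (VMon n m)] (E : SkewPBW R n) (lgs : LeftGroebnerSoluble R)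
    (G : Fin t → Fin m → A) (f : Fin m → A) : Part ((Fin t → A) × (Fin m → A)) :=
  PFun.fix (E.divStep lgs G) { h := f, quot := 0, rem := 0 }

/-- The monomials at which S-vectors have to be formed: the least common multiples of the leading
monomials of the members of nonempty subfamilies of `G`. -/
def lcms [LinearOrder (VMon n m)] (E : SkewPBW R n) (G : Fin t → Fin m → A) :
    List (VMon n m) :=
  (List.finRange t).sublists.filterMap fun J => VMon.lcm? (J.filterMap fun j => E.lm? (G j))

/-- The coefficient families of the S-vectors of `G`. For each of the monomials `X` above and each
generator `b` of the syzygies of the leading coefficients of the vectors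
`x ^ γⱼ • G j` with leading monomial `X`, the S-vector is `∑ bⱼ x ^ γⱼ • G j`. -/
def sFamilies [LinearOrder (VMon n m)] (E : SkewPBW R n) (lgs : LeftGroebnerSoluble R)
    (G : Fin t → Fin m → A) : List (Fin t → A) :=
  (E.lcms G).flatMap fun X =>
    (lgs.syz fun j => E.cofactorCoeff X (G j)).map fun b j => (b j : A) * E.cofactor X (G j)

/-- A list of vectors `g` of `A ^ s`, each with a row `c` of length `r` which is to express it
through the rows of a matrix `F` with `r` rows, `g = c F`. -/
abbrev Tracked (A : Type*) (r s : ℕ) := List ((Fin s → A) × (Fin r → A))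

/-- The vectors of a tracked list. -/
def Tracked.vecs (B : Tracked A r s) : Fin B.length → Fin s → A := fun j => (B.get j).1

/-- The matrix whose columns are the vectors of a tracked list. -/
def Tracked.G (B : Tracked A r s) : Matrix (Fin s) (Fin B.length) A := fun i j => (B.get j).1 i

/-- The matrix `H` whose `j`-th column holds the coefficients of the `j`-th vector of a tracked
list. -/
def Tracked.H (B : Tracked A r s) : Matrix (Fin r) (Fin B.length) A := fun i j => (B.get j).2 i

/-- One pass of the loop of Buchberger's algorithm: divide all S-vectors by the present list.
If all remainders are zero, return the list, otherwise append the nonzero remainders. -/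
def buchbergerStep [DecidableEq A] [LinearOrder (VMon n s)] (E : SkewPBW R n)
    (lgs : LeftGroebnerSoluble R) (B : Tracked A r s) : Part (Tracked A r s ⊕ Tracked A r s) :=
  let fam := E.sFamilies lgs B.vecs
  (runAll fun k : Fin fam.length =>
    (E.divide lgs B.vecs (∑ j, fam.get k j • B.vecs j)).map fun d =>
      (d.2, ∑ j, (fam.get k j - d.1 j) • (B.get j).2)).map fun rems =>
    let new := (List.ofFn rems).filter fun p => p.1 ≠ 0
    if new = [] then Sum.inl B else Sum.inr (B ++ new)

/-- Buchberger's algorithm for the left module generated by the rows of `F`. -/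
def buchberger [DecidableEq A] [LinearOrder (VMon n s)] (E : SkewPBW R n)
    (lgs : LeftGroebnerSoluble R) (F : Matrix (Fin r) (Fin s) A) : Part (Tracked A r s) :=
  PFun.fix (E.buchbergerStep lgs)
    ((List.ofFn fun i => (F i, (Pi.single i 1 : Fin r → A))).filter fun p => p.1 ≠ 0)

/-- The algorithm for the left inverse of an `r × s` matrix `F`, where `gb` is the program that
computes a Gröbner basis of the left module generated by the rows of `F`. The
value `none` is the answer that there is no left inverse.

If `r < s`, return `none`. Otherwise divide every canonical vector `eᵢ` by the Gröbner basis. If a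
remainder is not zero, return `none`; otherwise let `K` be the matrix whose `i`-th
column holds the quotients of the division of `eᵢ`, and return `Kᵀ Hᵀ`. -/
def leftInverseWith [DecidableEq A] [LinearOrder (VMon n s)] (E : SkewPBW R n)
    (lgs : LeftGroebnerSoluble R) (gb : Part (Tracked A r s)) :
    Part (Option (Matrix (Fin s) (Fin r) A)) :=
  if r < s then Part.some none
  else gb.bind fun B =>
    (runAll fun i : Fin s => E.divide lgs B.vecs (Pi.single i 1)).map fun d =>
      if ∀ i, (d i).2 = 0 then
        let K : Matrix (Fin B.length) (Fin s) A := fun j i => (d i).1 j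
        some (K.transpose * B.H.transpose)
      else none

/-- The algorithm for the left inverse of `F`, with Buchberger's algorithm as the program that
computes the Gröbner basis. -/
def leftInverse [DecidableEq A] [LinearOrder (VMon n s)] (E : SkewPBW R n)
    (lgs : LeftGroebnerSoluble R) (F : Matrix (Fin r) (Fin s) A) :
    Part (Option (Matrix (Fin s) (Fin r) A)) :=
  E.leftInverseWith lgs (E.buchberger lgs F)

/-- The left submodule of `A ^ s` generated by the rows of `F`. -/
def rowModule (F : Matrix (Fin r) (Fin s) A) : Submodule A (Fin s → A) :=
  Submodule.span A (Set.range fun i => F i)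

end SkewPBW

/-!
The proof rests on two facts about leading terms in a bijective skew PBW extension, both taken up to
terms of lower total degree: `x ^ α r = σ ^ α (r) x ^ α + ⋯` with an automorphism `σ ^ α` of `R`
(`SkewPBW.twist`), and `x ^ γ x ^ α = c x ^ (γ + α) + ⋯` with a unit `c` of `R`
(`SkewPBW.mulConst`). Since the monomial order refines the total degree, the lower terms never
matter: the leading monomial of `x ^ γ • f` is that of `f` shifted by `γ`, and its leading
coefficient is `σ ^ γ (lc f) c` (`SkewPBW.coeff_stdMonomial_smul_shift`).

Division ends because the monomial order is well-founded, and the remainder is zero or irreducible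
(`SkewPBW.divide_spec`). For a Gröbner basis the remainder therefore vanishes exactly on the
submodule.

A set of vectors cannot be enlarged for ever by vectors that are irreducible with
respect to the set already present (`SkewPBW.wellFounded_enlarges`). This combines Dickson's lemma
with the ascending chain condition of `R`: if the coefficient of a leading term is written
on the right of `x ^ α`, multiplication by `x ^ γ` only changes it by a unit on the left, so that
leading coefficients at different monomials can be compared in one chain of left ideals. It
follows that Buchberger's algorithm ends, and that `A ^ s`, hence `A`, is left Noetherian
(`SkewPBW.isNoetherian_vectors`).

When the algorithm stops, all S-vectors are combinations of the list with leading monomials below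
the least common multiple at which they are formed. Buchberger's criterion
(`SkewPBW.reducible_of_mem_bounded`) then applies: syzygies of leading coefficients at a monomial
`X` are carried by `σ ^ γ` to syzygies at the least common multiple of the leading monomials that
divide `X`, where they are left linear combinations of the given generators.

Finally, `F` has a left inverse if and only if the rows generate all canonical vectors. This cannot
happen for `r < s`: a nontrivial left Noetherian ring satisfies the strong rank condition
(`SkewPBW.le_of_leftInverse`).
-/

namespace SkewPBW

/-! ### Standard monomials -/

theorem stdMonomial_zero {A : Type*} [Ring A] {n : ℕ} (x : Fin n → A) : stdMonomial x 0 = 1 := by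
  simp [stdMonomial]

theorem stdMonomial_add_single {A : Type*} [Ring A] {n : ℕ} (x : Fin n → A) (k : Fin n)
    (α : Fin n → ℕ) (h : ∀ l < k, α l = 0) :
    stdMonomial x (α + Pi.single k 1) = x k * stdMonomial x α := by
  induction n with
  | zero => exact k.elim0
  | succ n ih =>
    simp only [stdMonomial, List.ofFn_succ, List.prod_cons]
    cases k using Fin.cases with
    | zero => simp [pow_succ', mul_assoc]
    | succ k =>
      have := ih (fun i => x i.succ) k (fun i => α i.succ)
        (fun l hl => h _ (Fin.succ_lt_succ_iff.2 hl))
      simp only [stdMonomial] at this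
      have h0 : α 0 = 0 := h 0 (Fin.succ_pos k)
      simp only [Pi.add_apply, h0, Pi.single_apply, Fin.succ_inj] at this ⊢
      simpa [Fin.succ_ne_zero, eq_comm] using this

/-- Every exponent is obtained from `0` by adding unit vectors `eₖ` for which `k` does not exceed
the support, so that each addition is a multiplication by `xₖ` on the left. -/
theorem exponent_induction {n : ℕ} {P : (Fin n → ℕ) → Prop} (h0 : P 0)
    (hs : ∀ (k : Fin n) (α : Fin n → ℕ), (∀ l < k, α l = 0) → P α → P (α + Pi.single k 1))
    (α : Fin n → ℕ) : P α := by
  induction hd : ∑ i, α i generalizing α with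
  | zero =>
    have : α = 0 := by
      funext i
      simpa using (Finset.sum_eq_zero_iff.1 hd) i (Finset.mem_univ i)
    rwa [this]
  | succ d ih =>
    have hne : (Finset.univ.filter fun i => α i ≠ 0).Nonempty := by
      by_contra hcon
      rw [Finset.not_nonempty_iff_eq_empty, Finset.filter_eq_empty_iff] at hcon
      have : ∑ i, α i = 0 := Finset.sum_eq_zero fun i hi => not_not.1 (hcon hi)
      omega
    set k := Finset.min' _ hne with hk
    have hk0 : α k ≠ 0 := (Finset.mem_filter.1 (Finset.min'_mem _ hne)).2
    have hmin : ∀ l < k, α l = 0 := by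
      intro l hl
      by_contra hcon
      exact absurd (Finset.min'_le _ l (Finset.mem_filter.2 ⟨Finset.mem_univ _, hcon⟩))
        (not_le.2 hl)
    have hα : α = (α - Pi.single k 1) + Pi.single k 1 := by
      funext i
      by_cases hi : i = k
      · subst hi
        simp only [Pi.add_apply, Pi.sub_apply, Pi.single_eq_same]
        omega
      · simp [hi]
    have hdeg : ∑ i, (α - Pi.single k 1 : Fin n → ℕ) i = d := by
      have h1 : ∑ i, α i = ∑ i, ((α - Pi.single k 1) + Pi.single k 1 : Fin n → ℕ) i := by
        rw [← hα]
      simp only [Pi.add_apply, Finset.sum_add_distrib, Finset.sum_pi_single', Finset.mem_univ,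
        if_true] at h1
      omega
    rw [hα]
    refine hs k _ (fun l hl => ?_) (ih _ hdeg)
    simp [hmin l hl]

theorem sum_add_single {n : ℕ} (α : Fin n → ℕ) (k : Fin n) :
    ∑ i, (α + Pi.single k 1 : Fin n → ℕ) i = ∑ i, α i + 1 := by
  simp [Finset.sum_add_distrib]

variable {A : Type*} [Ring A] {R : Subring A} {n : ℕ}

theorem x_eq_stdMonomial (E : SkewPBW R n) (i : Fin n) :
    E.x i = stdMonomial E.x (Pi.single i 1) := by
  have := stdMonomial_add_single E.x i 0 (fun _ _ => rfl)
  rw [zero_add, stdMonomial_zero, mul_one] at this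
  exact this.symm

/-! ### Coordinates -/

theorem linearCombination_bijective (E : SkewPBW R n) :
    Function.Bijective (Finsupp.linearCombination R (stdMonomial E.x)) :=
  ⟨E.linearIndependent, fun a => ⟨E.coord a, E.sum_coord a⟩⟩

/-- The coordinates with respect to the standard monomials, as an `R`-linear equivalence. -/
noncomputable def coordEquiv (E : SkewPBW R n) : A ≃ₗ[R] ((Fin n → ℕ) →₀ R) :=
  (LinearEquiv.ofBijective _ E.linearCombination_bijective).symm

theorem coordEquiv_apply (E : SkewPBW R n) (a : A) : E.coordEquiv a = E.coord a := by
  rw [coordEquiv, LinearEquiv.symm_apply_eq]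
  exact (E.sum_coord a).symm

theorem coord_add (E : SkewPBW R n) (a b : A) : E.coord (a + b) = E.coord a + E.coord b := by
  simp only [← coordEquiv_apply, map_add]

theorem coord_sub (E : SkewPBW R n) (a b : A) : E.coord (a - b) = E.coord a - E.coord b := by
  simp only [← coordEquiv_apply, map_sub]

theorem coord_zero (E : SkewPBW R n) : E.coord 0 = 0 := by
  simp only [← coordEquiv_apply, map_zero]

theorem coord_smul (E : SkewPBW R n) (r : R) (a : A) : E.coord (r • a) = r • E.coord a := by
  simp only [← coordEquiv_apply, map_smul]

theorem coord_sum (E : SkewPBW R n) {ι : Type*} (s : Finset ι) (f : ι → A) :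
    E.coord (∑ i ∈ s, f i) = ∑ i ∈ s, E.coord (f i) := by
  simp only [← coordEquiv_apply, map_sum]

theorem coord_injective (E : SkewPBW R n) : Function.Injective E.coord := fun a b h => by
  simp only [← coordEquiv_apply] at h
  exact E.coordEquiv.injective h

theorem coord_stdMonomial (E : SkewPBW R n) (α : Fin n → ℕ) :
    E.coord (stdMonomial E.x α) = Finsupp.single α 1 := by
  rw [← coordEquiv_apply, coordEquiv, LinearEquiv.symm_apply_eq]
  simp

theorem sum_coord_smul (E : SkewPBW R n) (a : A) :
    ∑ α ∈ (E.coord a).support, E.coord a α • stdMonomial E.x α = a := E.sum_coord a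

theorem coe_eq_smul (E : SkewPBW R n) (r : R) : (r : A) = r • stdMonomial E.x 0 := by
  rw [stdMonomial_zero, Subring.smul_def, smul_eq_mul, mul_one]

/-! ### The degree filtration -/

/-- The left `R`-submodule of the elements of `A` of total degree less than `d`. -/
def filt (E : SkewPBW R n) (d : ℕ) : Submodule R A :=
  Submodule.span R (stdMonomial E.x '' {α | ∑ i, α i < d})

theorem stdMonomial_mem_filt (E : SkewPBW R n) {α : Fin n → ℕ} {d : ℕ} (h : ∑ i, α i < d) :
    stdMonomial E.x α ∈ E.filt d := Submodule.subset_span ⟨α, h, rfl⟩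

theorem filt_mono (E : SkewPBW R n) {d e : ℕ} (h : d ≤ e) : E.filt d ≤ E.filt e :=
  Submodule.span_mono (Set.image_mono fun _ hα => lt_of_lt_of_le hα h)

theorem coord_eq_zero_of_mem_filt (E : SkewPBW R n) {d : ℕ} {a : A} (ha : a ∈ E.filt d)
    {α : Fin n → ℕ} (hα : d ≤ ∑ i, α i) : E.coord a α = 0 := by
  induction ha using Submodule.span_induction with
  | mem a h =>
    obtain ⟨β, hβ, rfl⟩ := h
    rw [coord_stdMonomial, Finsupp.single_apply, if_neg]
    rintro rfl
    exact absurd hβ (not_lt.2 hα)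
  | zero => rw [coord_zero]; rfl
  | add a b _ _ h1 h2 => rw [coord_add, Finsupp.add_apply, h1, h2, add_zero]
  | smul r a _ h => rw [coord_smul, Finsupp.smul_apply, h, smul_zero]

theorem coe_mem_filt (E : SkewPBW R n) (r : R) : (r : A) ∈ E.filt 1 := by
  rw [E.coe_eq_smul r]
  exact Submodule.smul_mem _ _ (E.stdMonomial_mem_filt (by simp))

theorem coord_eq_of_sub_mem_filt (E : SkewPBW R n) {a : A} {r : R} {α : Fin n → ℕ}
    (h : a - r • stdMonomial E.x α ∈ E.filt (∑ i, α i)) : E.coord a α = r := by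
  have := E.coord_eq_zero_of_mem_filt h le_rfl
  rw [coord_sub, coord_smul, coord_stdMonomial, Finsupp.sub_apply, Finsupp.smul_apply,
    Finsupp.single_eq_same, smul_eq_mul, mul_one] at this
  exact sub_eq_zero.1 this

theorem x_mul_coe (E : SkewPBW R n) (i : Fin n) (r : R) :
    ∃ d : R, E.x i * (r : A) = E.sigma i r • E.x i + (d : A) := by
  by_cases hr : r = 0
  · refine ⟨0, ?_⟩
    subst hr
    simp [sigma, coord_zero]
  · obtain ⟨c, -, hc⟩ := E.comm_coeff i r hr
    refine ⟨⟨_, hc⟩, ?_⟩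
    have : E.sigma i r = c := by
      refine E.coord_eq_of_sub_mem_filt ?_
      rw [← x_eq_stdMonomial, Subring.smul_def, smul_eq_mul]
      exact E.filt_mono (by simp) (E.coe_mem_filt ⟨_, hc⟩)
    rw [this, Subring.smul_def, smul_eq_mul]
    simp

theorem x_mul_coe_sub_mem (E : SkewPBW R n) (i : Fin n) (r : R) :
    E.x i * (r : A) - E.sigma i r • E.x i ∈ E.filt 1 := by
  obtain ⟨d, hd⟩ := E.x_mul_coe i r
  rw [hd, add_sub_cancel_left]
  exact E.coe_mem_filt d

/-- The maps `σᵢ` are ring endomorphisms. -/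
def sigmaHom (E : SkewPBW R n) (i : Fin n) : R →+* R where
  toFun := E.sigma i
  map_zero' := by simp [sigma, coord_zero]
  map_one' := by
    rw [sigma, Subring.coe_one, mul_one, x_eq_stdMonomial, coord_stdMonomial,
      Finsupp.single_eq_same]
  map_add' r s := by simp [sigma, mul_add, coord_add]
  map_mul' r s := by
    obtain ⟨d, hd⟩ := E.x_mul_coe i r
    refine E.coord_eq_of_sub_mem_filt ?_
    have : E.x i * ((r * s : R) : A) - (E.sigma i r * E.sigma i s) • stdMonomial E.x (Pi.single i 1)
        = E.sigma i r • (E.x i * (s : A) - E.sigma i s • E.x i) + ((d * s : R) : A) := by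
      rw [← x_eq_stdMonomial, Subring.coe_mul, ← mul_assoc, hd]
      simp only [Subring.smul_def, smul_eq_mul, Subring.coe_mul]
      noncomm_ring
    rw [this]
    refine Submodule.add_mem _ (Submodule.smul_mem _ _ ?_) ?_
    · exact E.filt_mono (by simp) (E.x_mul_coe_sub_mem i s)
    · exact E.filt_mono (by simp) (E.coe_mem_filt _)

/-- In a bijective extension the maps `σᵢ` are ring automorphisms. -/
noncomputable def sigmaEquiv (E : SkewPBW R n) (hE : E.IsBijective) (i : Fin n) : R ≃+* R :=
  RingEquiv.ofBijective (E.sigmaHom i) (hE.1 i)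

theorem x_mul_coe' (E : SkewPBW R n) (hE : E.IsBijective) (i : Fin n) (r : R) :
    ∃ d : R, E.x i * (r : A) = E.sigmaEquiv hE i r • E.x i + (d : A) := E.x_mul_coe i r

theorem x_mul_smul (E : SkewPBW R n) (hE : E.IsBijective) (i : Fin n) (r : R) :
    ∃ d : R, ∀ a : A, E.x i * (r • a) = E.sigmaEquiv hE i r • (E.x i * a) + d • a := by
  obtain ⟨d, hd⟩ := E.x_mul_coe' hE i r
  refine ⟨d, fun a => ?_⟩
  simp only [Subring.smul_def, smul_eq_mul] at hd ⊢
  rw [← mul_assoc, hd]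
  noncomm_ring

theorem x_mem_filt (E : SkewPBW R n) (i : Fin n) : E.x i ∈ E.filt 2 := by
  rw [x_eq_stdMonomial]
  exact E.stdMonomial_mem_filt (by simp)

theorem span_one_x_le_filt (E : SkewPBW R n) :
    Submodule.span R ({1} ∪ Set.range E.x) ≤ E.filt 2 := by
  rw [Submodule.span_le]
  rintro _ (rfl | ⟨i, rfl⟩)
  · exact E.filt_mono (by norm_num) (E.coe_mem_filt 1)
  · exact E.x_mem_filt i

theorem x_mul_x (E : SkewPBW R n) (hE : E.IsBijective) {i j : Fin n} (hij : i < j) :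
    ∃ u : Rˣ, E.x j * E.x i - (u : R) • (E.x i * E.x j) ∈
      Submodule.span R ({1} ∪ Set.range E.x) := by
  obtain ⟨c, -, hc⟩ := E.comm_var i j
  have hx : E.x i * E.x j = stdMonomial E.x (Pi.single i 1 + Pi.single j 1) := by
    rw [add_comm, stdMonomial_add_single _ _ _ fun l hl => ?_, ← x_eq_stdMonomial]
    rw [Pi.single_apply, if_neg (hl.trans hij).ne]
  have : E.varConst i j = c := by
    refine E.coord_eq_of_sub_mem_filt ?_
    rw [← hx]
    have h2 : ∑ l, (Pi.single i 1 + Pi.single j 1 : Fin n → ℕ) l = 2 := by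
      rw [sum_add_single]; simp
    rw [h2]
    exact E.span_one_x_le_filt hc
  obtain ⟨u, hu⟩ := hE.2 i j hij
  refine ⟨u, ?_⟩
  rw [hu, this]
  exact hc

theorem x_mul_mem_filt_aux (E : SkewPBW R n) (hE : E.IsBijective) {d : ℕ}
    (H : ∀ (i : Fin n) (α : Fin n → ℕ), ∑ l, α l < d → E.x i * stdMonomial E.x α ∈ E.filt (d + 1))
    (i : Fin n) {q : A} (hq : q ∈ E.filt d) : E.x i * q ∈ E.filt (d + 1) := by
  induction hq using Submodule.span_induction with
  | mem a h =>
    obtain ⟨β, hβ, rfl⟩ := h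
    exact H i β hβ
  | zero => rw [mul_zero]; exact zero_mem _
  | add a b _ _ h1 h2 => rw [mul_add]; exact add_mem h1 h2
  | smul r a ha h =>
    obtain ⟨e, he⟩ := E.x_mul_smul hE i r
    rw [he]
    exact add_mem (Submodule.smul_mem _ _ h)
      (Submodule.smul_mem _ _ (E.filt_mono (Nat.le_succ d) ha))

/-- Multiplication by a variable on the left, up to terms of lower degree. If `i` does not exceed
the support of `α`, the product is a standard monomial; otherwise the first variable of `x ^ α` is
moved to the front, and the terms which this produces are dealt with by induction on the degree. -/
theorem x_mul_stdMonomial (E : SkewPBW R n) (hE : E.IsBijective) (i : Fin n) (α : Fin n → ℕ) :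
    ∃ u : Rˣ, E.x i * stdMonomial E.x α - (u : R) • stdMonomial E.x (α + Pi.single i 1) ∈
      E.filt (∑ l, α l + 1) := by
  induction hd : ∑ l, α l using Nat.strong_induction_on generalizing i α with
  | _ d ih =>
  have H : ∀ (i : Fin n) (β : Fin n → ℕ), ∑ l, β l < d →
      E.x i * stdMonomial E.x β ∈ E.filt (d + 1) := by
    intro i β hβ
    obtain ⟨u, hu⟩ := ih _ hβ i β rfl
    rw [← sub_add_cancel (E.x i * stdMonomial E.x β)]
    refine add_mem (E.filt_mono (by omega) hu) (Submodule.smul_mem _ _ (E.stdMonomial_mem_filt ?_))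
    rw [sum_add_single]
    omega
  by_cases hi : ∀ l < i, α l = 0
  · refine ⟨1, ?_⟩
    rw [stdMonomial_add_single _ _ _ hi, Units.val_one, one_smul, sub_self]
    exact zero_mem _
  have hα : α = 0 ∨ ∃ (k : Fin n) (β : Fin n → ℕ), (∀ l < k, β l = 0) ∧ α = β + Pi.single k 1 :=
    exponent_induction (P := fun α => α = 0 ∨ ∃ (k : Fin n) (β : Fin n → ℕ),
      (∀ l < k, β l = 0) ∧ α = β + Pi.single k 1) (Or.inl rfl)
      (fun k β h _ => Or.inr ⟨k, β, h, rfl⟩) α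
  rcases hα with rfl | ⟨k, β, hβ, rfl⟩
  · exact absurd (fun _ _ => rfl) hi
  rw [sum_add_single] at hd
  have hki : k < i := by
    by_contra hcon
    refine hi fun l hl => ?_
    have hlk : l < k := lt_of_lt_of_le hl (not_lt.1 hcon)
    simp [hβ l hlk, hlk.ne]
  obtain ⟨c, hc⟩ := E.x_mul_x hE hki
  obtain ⟨u, hu⟩ := ih _ (by omega) i β rfl
  obtain ⟨e, he⟩ := E.x_mul_smul hE k u
  have hks : ∀ l < k, (β + Pi.single i 1 : Fin n → ℕ) l = 0 := by
    intro l hl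
    simp [hβ l hl, (hl.trans hki).ne]
  have hp : ∀ p ∈ Submodule.span R ({1} ∪ Set.range E.x),
      p * stdMonomial E.x β ∈ E.filt (d + 1) := by
    intro p hp
    induction hp using Submodule.span_induction with
    | mem a h =>
      rcases h with rfl | ⟨l, rfl⟩
      · rw [one_mul]; exact E.stdMonomial_mem_filt (by omega)
      · exact H l β (by omega)
    | zero => rw [zero_mul]; exact zero_mem _
    | add a b _ _ h1 h2 => rw [add_mul]; exact add_mem h1 h2
    | smul r a ha h => rw [smul_mul_assoc]; exact Submodule.smul_mem _ _ h
  refine ⟨c * Units.map (E.sigmaEquiv hE k : R →* R) u, ?_⟩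
  have key : E.x i * stdMonomial E.x (β + Pi.single k 1) -
      ((c * Units.map (E.sigmaEquiv hE k : R →* R) u : Rˣ) : R) •
        stdMonomial E.x (β + Pi.single k 1 + Pi.single i 1) =
      (E.x i * E.x k - (c : R) • (E.x k * E.x i)) * stdMonomial E.x β +
      (c : R) • (E.x k * (E.x i * stdMonomial E.x β - (u : R) • stdMonomial E.x (β + Pi.single i 1))
        + e • stdMonomial E.x (β + Pi.single i 1)) := by
    rw [add_right_comm, stdMonomial_add_single _ _ _ hks, stdMonomial_add_single _ _ _ hβ,
      mul_sub, he]
    simp only [Units.val_mul, Units.coe_map, MonoidHom.coe_coe,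
      mul_smul, smul_add, smul_sub, sub_mul, smul_mul_assoc, mul_assoc]
    abel
  rw [key]
  refine add_mem (hp _ hc) (Submodule.smul_mem _ _ (add_mem ?_ (Submodule.smul_mem _ _ ?_)))
  · exact E.x_mul_mem_filt_aux hE H k (E.filt_mono (by omega) hu)
  · refine E.stdMonomial_mem_filt ?_
    rw [sum_add_single]
    omega

theorem x_mul_mem_filt (E : SkewPBW R n) (hE : E.IsBijective) (i : Fin n) {d : ℕ} {q : A}
    (hq : q ∈ E.filt d) : E.x i * q ∈ E.filt (d + 1) := by
  refine E.x_mul_mem_filt_aux hE (fun i α hα => ?_) i hq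
  obtain ⟨u, hu⟩ := E.x_mul_stdMonomial hE i α
  rw [← sub_add_cancel (E.x i * stdMonomial E.x α)]
  refine add_mem (E.filt_mono (by omega) hu) (Submodule.smul_mem _ _ (E.stdMonomial_mem_filt ?_))
  rw [sum_add_single]
  omega

theorem stdMonomial_mul_mem_filt (E : SkewPBW R n) (hE : E.IsBijective) (α : Fin n → ℕ) {d : ℕ}
    {q : A} (hq : q ∈ E.filt d) : stdMonomial E.x α * q ∈ E.filt (∑ l, α l + d) := by
  induction α using exponent_induction with
  | h0 => simpa [stdMonomial_zero] using hq
  | hs k α hk ih =>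
    rw [stdMonomial_add_single _ _ _ hk, mul_assoc, sum_add_single, add_right_comm]
    exact E.x_mul_mem_filt hE k ih

theorem mul_mem_filt (E : SkewPBW R n) (hE : E.IsBijective) {d e : ℕ} {p q : A}
    (hp : p ∈ E.filt d) (hq : q ∈ E.filt (e + 1)) : p * q ∈ E.filt (d + e) := by
  induction hp using Submodule.span_induction with
  | mem a h =>
    obtain ⟨β, hβ, rfl⟩ := h
    have hβ : ∑ l, β l < d := hβ
    exact E.filt_mono (by omega) (E.stdMonomial_mul_mem_filt hE β hq)
  | zero => rw [zero_mul]; exact zero_mem _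
  | add a b _ _ h1 h2 => rw [add_mul]; exact add_mem h1 h2
  | smul r a ha h => rw [smul_mul_assoc]; exact Submodule.smul_mem _ _ h

theorem exists_twist (E : SkewPBW R n) (hE : E.IsBijective) (α : Fin n → ℕ) :
    ∃ φ : R ≃+* R, ∀ r : R,
      stdMonomial E.x α * (r : A) - φ r • stdMonomial E.x α ∈ E.filt (∑ l, α l) := by
  induction α using exponent_induction with
  | h0 =>
    refine ⟨RingEquiv.refl R, fun r => ?_⟩
    simp [stdMonomial_zero, Subring.smul_def]
  | hs k α hk ih =>
    obtain ⟨φ, hφ⟩ := ih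
    refine ⟨φ.trans (E.sigmaEquiv hE k), fun r => ?_⟩
    obtain ⟨e, he⟩ := E.x_mul_smul hE k (φ r)
    have key : stdMonomial E.x (α + Pi.single k 1) * (r : A) -
        φ.trans (E.sigmaEquiv hE k) r • stdMonomial E.x (α + Pi.single k 1) =
        E.x k * (stdMonomial E.x α * (r : A) - φ r • stdMonomial E.x α) +
          e • stdMonomial E.x α := by
      rw [stdMonomial_add_single _ _ _ hk, mul_sub, he, mul_assoc, RingEquiv.trans_apply]
      abel
    rw [key, sum_add_single]
    exact add_mem (E.x_mul_mem_filt hE k (hφ r))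
      (Submodule.smul_mem _ _ (E.stdMonomial_mem_filt (Nat.lt_succ_self _)))

/-- The automorphism `σ ^ α` of `R` with `x ^ α r = σ ^ α (r) x ^ α + ⋯`, where the dots stand for
terms of lower degree. -/
noncomputable def twist (E : SkewPBW R n) (hE : E.IsBijective) (α : Fin n → ℕ) : R ≃+* R :=
  (E.exists_twist hE α).choose

theorem twist_spec (E : SkewPBW R n) (hE : E.IsBijective) (α : Fin n → ℕ) (r : R) :
    stdMonomial E.x α * (r : A) - E.twist hE α r • stdMonomial E.x α ∈ E.filt (∑ l, α l) :=
  (E.exists_twist hE α).choose_spec r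

theorem exists_mulConst (E : SkewPBW R n) (hE : E.IsBijective) (α β : Fin n → ℕ) :
    ∃ u : Rˣ, stdMonomial E.x α * stdMonomial E.x β - (u : R) • stdMonomial E.x (α + β) ∈
      E.filt (∑ l, (α + β) l) := by
  induction α using exponent_induction with
  | h0 => exact ⟨1, by simp [stdMonomial_zero]⟩
  | hs k α hk ih =>
    obtain ⟨u, hu⟩ := ih
    obtain ⟨v, hv⟩ := E.x_mul_stdMonomial hE k (α + β)
    obtain ⟨e, he⟩ := E.x_mul_smul hE k u
    refine ⟨Units.map (E.sigmaEquiv hE k : R →* R) u * v, ?_⟩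
    have key : stdMonomial E.x (α + Pi.single k 1) * stdMonomial E.x β -
        ((Units.map (E.sigmaEquiv hE k : R →* R) u * v : Rˣ) : R) •
          stdMonomial E.x (α + Pi.single k 1 + β) =
        E.x k * (stdMonomial E.x α * stdMonomial E.x β - (u : R) • stdMonomial E.x (α + β)) +
        (E.sigmaEquiv hE k u • (E.x k * stdMonomial E.x (α + β) -
          (v : R) • stdMonomial E.x (α + β + Pi.single k 1)) + e • stdMonomial E.x (α + β)) := by
      rw [add_right_comm, stdMonomial_add_single _ _ _ hk, mul_sub, he, mul_assoc]
      simp only [Units.val_mul, Units.coe_map, MonoidHom.coe_coe,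
        mul_smul, smul_sub]
      abel
    rw [key, add_right_comm, sum_add_single]
    exact add_mem (E.x_mul_mem_filt hE k hu) (add_mem (Submodule.smul_mem _ _ hv)
      (Submodule.smul_mem _ _ (E.stdMonomial_mem_filt (Nat.lt_succ_self _))))

/-- The unit `c` of `R` with `x ^ α x ^ β = c x ^ (α + β) + ⋯`, where the dots stand for terms of
lower degree. -/
noncomputable def mulConst (E : SkewPBW R n) (hE : E.IsBijective) (α β : Fin n → ℕ) : Rˣ :=
  (E.exists_mulConst hE α β).choose

theorem mulConst_spec (E : SkewPBW R n) (hE : E.IsBijective) (α β : Fin n → ℕ) :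
    stdMonomial E.x α * stdMonomial E.x β - (E.mulConst hE α β : R) • stdMonomial E.x (α + β) ∈
      E.filt (∑ l, (α + β) l) :=
  (E.exists_mulConst hE α β).choose_spec

/-- The product of `x ^ γ` and a term `r x ^ β`, up to terms of lower degree. -/
theorem stdMonomial_mul_smul (E : SkewPBW R n) (hE : E.IsBijective) (γ β : Fin n → ℕ) (r : R) :
    stdMonomial E.x γ * (r • stdMonomial E.x β) -
      (E.twist hE γ r * E.mulConst hE γ β) • stdMonomial E.x (γ + β) ∈
      E.filt (∑ l, (γ + β) l) := by
  have key : stdMonomial E.x γ * (r • stdMonomial E.x β) -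
      (E.twist hE γ r * E.mulConst hE γ β) • stdMonomial E.x (γ + β) =
      (stdMonomial E.x γ * (r : A) - E.twist hE γ r • stdMonomial E.x γ) * stdMonomial E.x β +
      E.twist hE γ r • (stdMonomial E.x γ * stdMonomial E.x β -
        (E.mulConst hE γ β : R) • stdMonomial E.x (γ + β)) := by
    simp only [Subring.smul_def, smul_eq_mul, Subring.coe_mul]
    noncomm_ring
  rw [key]
  refine add_mem ?_ (Submodule.smul_mem _ _ (E.mulConst_spec hE γ β))
  have := E.mul_mem_filt hE (E.twist_spec hE γ r)
    (E.stdMonomial_mem_filt (Nat.lt_succ_self (∑ l, β l)))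
  simpa [Finset.sum_add_distrib] using this

/-- The associativity of `(x ^ γ x ^ α) r = x ^ γ (x ^ α r)`, read off at the leading
coefficients. -/
theorem twist_twist (E : SkewPBW R n) (hE : E.IsBijective) (γ α : Fin n → ℕ) (r : R) :
    E.twist hE γ (E.twist hE α r) * E.mulConst hE γ α =
      E.mulConst hE γ α * E.twist hE (γ + α) r := by
  have h1 : E.coord (stdMonomial E.x γ * stdMonomial E.x α * (r : A)) (γ + α) =
      E.twist hE γ (E.twist hE α r) * E.mulConst hE γ α := by
    refine E.coord_eq_of_sub_mem_filt ?_
    have key : stdMonomial E.x γ * stdMonomial E.x α * (r : A) -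
        (E.twist hE γ (E.twist hE α r) * E.mulConst hE γ α) • stdMonomial E.x (γ + α) =
        stdMonomial E.x γ * (stdMonomial E.x α * (r : A) - E.twist hE α r • stdMonomial E.x α) +
        (stdMonomial E.x γ * (E.twist hE α r • stdMonomial E.x α) -
          (E.twist hE γ (E.twist hE α r) * E.mulConst hE γ α) • stdMonomial E.x (γ + α)) := by
      rw [mul_sub, mul_assoc]
      abel
    rw [key]
    refine add_mem ?_ (E.stdMonomial_mul_smul hE γ α _)
    simpa [Finset.sum_add_distrib] using E.stdMonomial_mul_mem_filt hE γ (E.twist_spec hE α r)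
  have h2 : E.coord (stdMonomial E.x γ * stdMonomial E.x α * (r : A)) (γ + α) =
      E.mulConst hE γ α * E.twist hE (γ + α) r := by
    refine E.coord_eq_of_sub_mem_filt ?_
    have key : stdMonomial E.x γ * stdMonomial E.x α * (r : A) -
        (E.mulConst hE γ α * E.twist hE (γ + α) r) • stdMonomial E.x (γ + α) =
        (stdMonomial E.x γ * stdMonomial E.x α -
          (E.mulConst hE γ α : R) • stdMonomial E.x (γ + α)) * (r : A) +
        (E.mulConst hE γ α : R) • (stdMonomial E.x (γ + α) * (r : A) -
          E.twist hE (γ + α) r • stdMonomial E.x (γ + α)) := by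
      rw [sub_mul, smul_sub, smul_mul_assoc, mul_smul]
      abel
    rw [key]
    have h := E.mul_mem_filt hE (e := 0) (E.mulConst_spec hE γ α) (E.coe_mem_filt r)
    rw [add_zero] at h
    exact add_mem h (Submodule.smul_mem _ _ (E.twist_spec hE (γ + α) r))
  rw [← h1, h2]

end SkewPBW

/-! ### Monomials of `A ^ m` -/

theorem VMon.shift_shift {n m : ℕ} (γ β : Fin n → ℕ) (X : VMon n m) :
    (X.shift β).shift γ = X.shift (γ + β) := by
  simp [VMon.shift, add_assoc]

theorem VMon.Divides.shift_sub {n m : ℕ} {X Y : VMon n m} (h : Y.Divides X) :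
    Y.shift (fun i => X.exp i - Y.exp i) = X := by
  refine VMon.ext (funext fun i => ?_) h.1
  exact Nat.sub_add_cancel (h.2 i)

theorem VMon.divides_shift {n m : ℕ} (γ : Fin n → ℕ) (Y : VMon n m) : Y.Divides (Y.shift γ) :=
  ⟨rfl, fun _ => Nat.le_add_left _ _⟩

theorem VMon.Divides.trans {n m : ℕ} {X Y Z : VMon n m} (h : X.Divides Y) (h' : Y.Divides Z) :
    X.Divides Z := ⟨h.1.trans h'.1, fun i => (h.2 i).trans (h'.2 i)⟩

theorem VMon.lcm?_spec {n m : ℕ} {l : List (VMon n m)} (hl : l ≠ []) {X : VMon n m}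
    (h : ∀ Y ∈ l, Y.Divides X) :
    ∃ Z, VMon.lcm? l = some Z ∧ Z.Divides X ∧ ∀ Y ∈ l, Y.Divides Z := by
  cases l with
  | nil => exact absurd rfl hl
  | cons W l =>
    have hidx : ∀ Y ∈ l, Y.idx = W.idx := fun Y hY =>
      (h Y (List.mem_cons_of_mem _ hY)).1.trans (h W List.mem_cons_self).1.symm
    refine ⟨_, if_pos hidx, ⟨(h W List.mem_cons_self).1, fun i => ?_⟩, ?_⟩
    · have aux : ∀ l' : List (VMon n m), (∀ Y ∈ l', Y.exp i ≤ X.exp i) →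
          l'.foldr (fun Y a => max (Y.exp i) a) (W.exp i) ≤ X.exp i := by
        intro l' hl'
        induction l' with
        | nil => exact (h W List.mem_cons_self).2 i
        | cons Y l' ih =>
          exact max_le (hl' Y List.mem_cons_self)
            (ih fun Z hZ => hl' Z (List.mem_cons_of_mem _ hZ))
      exact aux l fun Y hY => (h Y (List.mem_cons_of_mem _ hY)).2 i
    · have aux : ∀ (l' : List (VMon n m)) (i : Fin n),
          W.exp i ≤ l'.foldr (fun Y a => max (Y.exp i) a) (W.exp i) ∧
          ∀ Y ∈ l', Y.exp i ≤ l'.foldr (fun Y a => max (Y.exp i) a) (W.exp i) := by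
        intro l' i
        induction l' with
        | nil => simp
        | cons Y l' ih =>
          refine ⟨ih.1.trans (le_max_right _ _), fun Z hZ => ?_⟩
          rcases List.mem_cons.1 hZ with rfl | hZ
          · exact le_max_left _ _
          · exact (ih.2 Z hZ).trans (le_max_right _ _)
      intro Y hY
      rcases List.mem_cons.1 hY with rfl | hY
      · exact ⟨rfl, fun i => (aux l i).1⟩
      · exact ⟨hidx Y hY, fun i => (aux l i).2 Y hY⟩

/-- Dickson's lemma: a sequence of monomials has a subsequence in which each member divides the
later ones. -/
theorem VMon.exists_divides_subseq {n m : ℕ} (X : ℕ → VMon n m) :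
    ∃ φ : ℕ → ℕ, StrictMono φ ∧ ∀ i j, i ≤ j → (X (φ i)).Divides (X (φ j)) := by
  obtain ⟨g, hg⟩ := (wellQuasiOrdered_le (α := Fin n → ℕ)).exists_monotone_subseq
    fun k => (X k).exp
  obtain ⟨h, hh⟩ := (Finite.wellQuasiOrdered (α := Fin m) (· = ·)).exists_monotone_subseq
    fun k => (X (g k)).idx
  exact ⟨g ∘ h, g.strictMono.comp h.strictMono,
    fun i j hij => ⟨hh i j hij, hg _ _ (h.monotone hij)⟩⟩

namespace IsMonomialOrder

variable {n m : ℕ} [LinearOrder (VMon n m)]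

theorem shift_lt (hord : IsMonomialOrder n m) (γ : Fin n → ℕ) {X Y : VMon n m} (h : X < Y) :
    X.shift γ < Y.shift γ := by
  refine lt_of_le_of_ne (hord.shift_le γ X Y h.le) fun heq => h.ne ?_
  rw [VMon.ext_iff] at heq
  exact VMon.ext (add_left_cancel heq.1) heq.2

theorem degree_le (hord : IsMonomialOrder n m) {X Y : VMon n m} (h : X ≤ Y) :
    ∑ i, X.exp i ≤ ∑ i, Y.exp i := by
  by_contra hcon
  exact absurd h (not_le.2 (hord.lt_of_degree_lt _ _ (not_le.1 hcon)))

/-- There are only finitely many monomials of bounded degree, so the order is well-founded. -/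
theorem wellFoundedLT (hord : IsMonomialOrder n m) : WellFoundedLT (VMon n m) := by
  have hfin : ∀ X : VMon n m, (Set.Iio X).Finite := by
    intro X
    have : Set.Finite {p : (Fin n → ℕ) × Fin m | p.1 ≤ fun _ => ∑ i, X.exp i} :=
      (Set.Finite.prod (Set.finite_Iic (fun _ : Fin n => ∑ i, X.exp i))
        (Set.finite_univ (α := Fin m))).subset fun p hp => ⟨hp, trivial⟩
    refine Set.Finite.of_finite_image (f := fun Y : VMon n m => (Y.exp, Y.idx))
      (this.subset ?_) ?_
    · rintro _ ⟨Y, hY, rfl⟩ i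
      exact (Finset.single_le_sum (f := Y.exp) (fun _ _ => Nat.zero_le _)
        (Finset.mem_univ i)).trans (hord.degree_le (le_of_lt hY))
    · intro Y _ Z _ h
      exact VMon.ext (congrArg Prod.fst h) (congrArg Prod.snd h)
  have hmono : StrictMono fun X : VMon n m => (Set.Iio X).ncard := fun X Y h =>
    Set.ncard_lt_ncard (Set.Iio_ssubset_Iio h) (hfin Y)
  exact hmono.wellFoundedLT

end IsMonomialOrder

/-! ### Coefficients and leading monomials of vectors -/

namespace SkewPBW

variable {A : Type*} [Ring A] {R : Subring A} {n m t : ℕ}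

theorem coeff_add (E : SkewPBW R n) (f g : Fin m → A) (X : VMon n m) :
    E.coeff (f + g) X = E.coeff f X + E.coeff g X := by
  simp [coeff, coord_add]

theorem coeff_sub (E : SkewPBW R n) (f g : Fin m → A) (X : VMon n m) :
    E.coeff (f - g) X = E.coeff f X - E.coeff g X := by
  simp [coeff, coord_sub]

theorem coeff_zero (E : SkewPBW R n) (X : VMon n m) : E.coeff (0 : Fin m → A) X = 0 := by
  simp [coeff, coord_zero]

theorem coeff_smul (E : SkewPBW R n) (r : R) (f : Fin m → A) (X : VMon n m) :
    E.coeff (r • f) X = r * E.coeff f X := by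
  simp [coeff, coord_smul]

theorem coeff_sum (E : SkewPBW R n) {ι : Type*} (s : Finset ι) (f : ι → Fin m → A)
    (X : VMon n m) : E.coeff (∑ i ∈ s, f i) X = ∑ i ∈ s, E.coeff (f i) X := by
  simp [coeff, coord_sum, Finset.sum_apply]

theorem eq_zero_of_coeff_eq_zero (E : SkewPBW R n) {f : Fin m → A}
    (h : ∀ X : VMon n m, E.coeff f X = 0) : f = 0 := by
  funext i
  refine E.coord_injective (Finsupp.ext fun α => ?_)
  rw [Pi.zero_apply, coord_zero]
  exact h ⟨α, i⟩

/-- The vectors all of whose monomials lie in the set `S`. -/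
def supported (E : SkewPBW R n) (S : Set (VMon n m)) : Submodule R (Fin m → A) where
  carrier := {f | ∀ X ∉ S, E.coeff f X = 0}
  zero_mem' X _ := E.coeff_zero X
  add_mem' hf hg X hX := by rw [coeff_add, hf X hX, hg X hX, add_zero]
  smul_mem' r f hf X hX := by rw [coeff_smul, hf X hX, mul_zero]

theorem supported_mono (E : SkewPBW R n) {S T : Set (VMon n m)} (h : S ⊆ T) :
    E.supported S ≤ E.supported T := fun _ hf X hX => hf X fun hS => hX (h hS)

theorem coeff_stdMonomial_smul (E : SkewPBW R n) (γ : Fin n → ℕ)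
    (f : Fin m → A) (Y : VMon n m) :
    E.coeff (stdMonomial E.x γ • f) Y = ∑ α ∈ (E.coord (f Y.idx)).support,
      E.coord (stdMonomial E.x γ * (E.coord (f Y.idx) α • stdMonomial E.x α)) Y.exp := by
  conv_lhs => rw [coeff, Pi.smul_apply, smul_eq_mul, ← E.sum_coord_smul (f Y.idx), Finset.mul_sum,
    coord_sum, Finsupp.finsetSum_apply]

variable [LinearOrder (VMon n m)]

theorem coeff_single (E : SkewPBW R n) (X Y : VMon n m) (r : R) :
    E.coeff (Pi.single X.idx ((r : A) * stdMonomial E.x X.exp)) Y = if Y = X then r else 0 := by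
  have hr : (r : A) * stdMonomial E.x X.exp = r • stdMonomial E.x X.exp := rfl
  rw [coeff, hr]
  by_cases hi : Y.idx = X.idx
  · rw [hi, Pi.single_eq_same, coord_smul, coord_stdMonomial, Finsupp.smul_apply,
      Finsupp.single_apply]
    simp [VMon.ext_iff, hi, eq_comm]
  · rw [Pi.single_eq_of_ne hi, coord_zero, if_neg fun h => hi (congrArg VMon.idx h)]
    rfl

theorem mem_monomials (E : SkewPBW R n) (f : Fin m → A) (X : VMon n m) :
    X ∈ E.monomials f ↔ E.coeff f X ≠ 0 := by
  simp only [monomials, Finset.mem_biUnion, Finset.mem_univ, true_and, Finset.mem_image,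
    Finsupp.mem_support_iff, coeff]
  constructor
  · rintro ⟨i, α, h, rfl⟩
    exact h
  · exact fun h => ⟨X.idx, X.exp, h, rfl⟩

theorem lm?_eq_none_iff (E : SkewPBW R n) (f : Fin m → A) : E.lm? f = none ↔ f = 0 := by
  rw [lm?]
  split_ifs with h
  · obtain ⟨X, hX⟩ := h
    rw [mem_monomials] at hX
    simp only [false_iff]
    rintro rfl
    exact hX (E.coeff_zero X)
  · simp only [true_iff]
    refine E.eq_zero_of_coeff_eq_zero fun X => ?_
    by_contra hX
    exact h ⟨X, (E.mem_monomials f X).2 hX⟩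

theorem lm?_eq_some_iff (E : SkewPBW R n) (f : Fin m → A) (X : VMon n m) :
    E.lm? f = some X ↔ E.coeff f X ≠ 0 ∧ f ∈ E.supported (Set.Iic X) := by
  rw [lm?]
  split_ifs with h
  · rw [Option.some.injEq, Finset.max'_eq_iff, mem_monomials]
    refine and_congr_right fun _ => forall_congr' fun Y => ?_
    rw [mem_monomials, Set.mem_Iic, not_imp_comm]
  · simp only [false_iff]
    exact fun hX => h ⟨X, (E.mem_monomials f X).2 hX.1⟩

/-- A vector without monomials above `X` and without the monomial `X` has only monomials
below `X`. -/
theorem mem_supported_Iio (E : SkewPBW R n) {f : Fin m → A} {X : VMon n m}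
    (h : f ∈ E.supported (Set.Iic X)) (h0 : E.coeff f X = 0) : f ∈ E.supported (Set.Iio X) := by
  intro Y hY
  rcases (not_lt.1 hY).eq_or_lt with rfl | hlt
  · exact h0
  · exact h Y (not_le.2 hlt)

theorem coord_stdMonomial_mul_smul_eq_zero (E : SkewPBW R n) (hE : E.IsBijective)
    (γ α β : Fin n → ℕ) (r : R) (hne : β ≠ γ + α) (hdeg : ∑ i, (γ + α) i ≤ ∑ i, β i) :
    E.coord (stdMonomial E.x γ * (r • stdMonomial E.x α)) β = 0 := by
  have := E.coord_eq_zero_of_mem_filt (E.stdMonomial_mul_smul hE γ α r) hdeg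
  rwa [coord_sub, coord_smul, coord_stdMonomial, Finsupp.sub_apply, Finsupp.smul_apply,
    Finsupp.single_eq_of_ne hne, smul_zero, sub_zero] at this

theorem stdMonomial_smul_mem_supported (E : SkewPBW R n) (hE : E.IsBijective)
    (hord : IsMonomialOrder n m) (γ : Fin n → ℕ) {f : Fin m → A} {X : VMon n m}
    (hf : f ∈ E.supported (Set.Iic X)) :
    stdMonomial E.x γ • f ∈ E.supported (Set.Iic (X.shift γ)) := by
  intro Y hY
  rw [coeff_stdMonomial_smul]
  refine Finset.sum_eq_zero fun α hα => ?_
  have hle : (⟨α, Y.idx⟩ : VMon n m) ≤ X := by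
    by_contra hcon
    exact Finsupp.mem_support_iff.1 hα (hf ⟨α, Y.idx⟩ hcon)
  have hlt : (⟨α, Y.idx⟩ : VMon n m).shift γ < Y :=
    lt_of_le_of_lt (hord.shift_le γ _ _ hle) (not_le.1 hY)
  refine E.coord_stdMonomial_mul_smul_eq_zero hE γ α _ _ (fun h => hlt.ne ?_)
    (hord.degree_le hlt.le)
  exact VMon.ext h.symm rfl

/-- The leading coefficient of `x ^ γ • f`. -/
theorem coeff_stdMonomial_smul_shift (E : SkewPBW R n) (hE : E.IsBijective)
    (hord : IsMonomialOrder n m) (γ : Fin n → ℕ) {f : Fin m → A} {X : VMon n m}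
    (hf : f ∈ E.supported (Set.Iic X)) :
    E.coeff (stdMonomial E.x γ • f) (X.shift γ) =
      E.twist hE γ (E.coeff f X) * E.mulConst hE γ X.exp := by
  rw [coeff_stdMonomial_smul]
  have hmain : E.coord (stdMonomial E.x γ * (E.coord (f X.idx) X.exp • stdMonomial E.x X.exp))
      (γ + X.exp) = E.twist hE γ (E.coeff f X) * E.mulConst hE γ X.exp :=
    E.coord_eq_of_sub_mem_filt (E.stdMonomial_mul_smul hE γ X.exp _)
  rw [← hmain]
  refine Finset.sum_eq_single X.exp (fun α hα hne => ?_) (fun h0 => ?_)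
  · have hle : (⟨α, X.idx⟩ : VMon n m) ≤ X := by
      by_contra hcon
      exact Finsupp.mem_support_iff.1 hα (hf ⟨α, X.idx⟩ hcon)
    refine E.coord_stdMonomial_mul_smul_eq_zero hE γ α _ _ (fun h => hne ?_)
      (hord.degree_le (hord.shift_le γ _ _ hle))
    exact (add_left_cancel h).symm
  · have h0 : E.coord (f X.idx) X.exp = 0 := Finsupp.notMem_support_iff.1 h0
    change E.coord (stdMonomial E.x γ * (E.coord (f X.idx) X.exp • stdMonomial E.x X.exp)) _ = 0
    rw [h0, zero_smul, mul_zero, coord_zero]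
    rfl

/-! ### Cofactors -/

theorem cofactor_of_divides (E : SkewPBW R n) {X Y : VMon n m} {g : Fin m → A}
    (hg : E.lm? g = some Y) (h : Y.Divides X) :
    E.cofactor X g = stdMonomial E.x fun i => X.exp i - Y.exp i := by
  simp [cofactor, hg, h]

theorem cofactor_shift (E : SkewPBW R n) {Y : VMon n m} {g : Fin m → A}
    (hg : E.lm? g = some Y) (γ : Fin n → ℕ) :
    E.cofactor (Y.shift γ) g = stdMonomial E.x γ := by
  rw [E.cofactor_of_divides hg (VMon.divides_shift γ Y)]
  congr 1
  funext i
  exact Nat.add_sub_cancel (γ i) (Y.exp i)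

theorem cofactor_eq_zero_or (E : SkewPBW R n) (X : VMon n m) (g : Fin m → A) :
    (E.cofactor X g = 0 ∧ ¬ ∃ Y, E.lm? g = some Y ∧ Y.Divides X) ∨
    ∃ Y γ, E.lm? g = some Y ∧ Y.shift γ = X ∧ E.cofactor X g = stdMonomial E.x γ := by
  by_cases h : ∃ Y, E.lm? g = some Y ∧ Y.Divides X
  · obtain ⟨Y, hY, hd⟩ := h
    exact Or.inr ⟨Y, _, hY, hd.shift_sub, E.cofactor_of_divides hY hd⟩
  · refine Or.inl ⟨?_, h⟩
    rw [cofactor]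
    split
    · rename_i Y hY
      exact if_neg fun hd => h ⟨Y, hY, hd⟩
    · rfl

theorem cofactor_smul_mem_supported (E : SkewPBW R n) (hE : E.IsBijective)
    (hord : IsMonomialOrder n m) (X : VMon n m) (g : Fin m → A) :
    E.cofactor X g • g ∈ E.supported (Set.Iic X) := by
  rcases E.cofactor_eq_zero_or X g with ⟨h, -⟩ | ⟨Y, γ, hY, rfl, h⟩
  · rw [h, zero_smul]
    exact zero_mem _
  · rw [h]
    exact E.stdMonomial_smul_mem_supported hE hord γ ((E.lm?_eq_some_iff g Y).1 hY).2

theorem cofactorCoeff_shift (E : SkewPBW R n) (hE : E.IsBijective)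
    (hord : IsMonomialOrder n m) {Y : VMon n m} {g : Fin m → A} (hg : E.lm? g = some Y)
    (γ : Fin n → ℕ) :
    E.cofactorCoeff (Y.shift γ) g = E.twist hE γ (E.coeff g Y) * E.mulConst hE γ Y.exp := by
  rw [cofactorCoeff, E.cofactor_shift hg,
    E.coeff_stdMonomial_smul_shift hE hord γ ((E.lm?_eq_some_iff g Y).1 hg).2]

theorem coeff_smul_eq_zero_of_mem_filt (E : SkewPBW R n) (hE : E.IsBijective)
    (hord : IsMonomialOrder n m) {d : ℕ} {p : A} (hp : p ∈ E.filt d) {g : Fin m → A}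
    {Y Z : VMon n m} (hg : g ∈ E.supported (Set.Iic Y)) (hd : d + ∑ i, Y.exp i ≤ ∑ i, Z.exp i) :
    E.coeff (p • g) Z = 0 := by
  induction hp using Submodule.span_induction with
  | mem a h =>
    obtain ⟨β, hβ, rfl⟩ := h
    have hβ : ∑ i, β i < d := hβ
    refine E.stdMonomial_smul_mem_supported hE hord β hg Z (not_le.2 ?_)
    refine hord.lt_of_degree_lt _ _ ?_
    simp only [VMon.shift, Pi.add_apply, Finset.sum_add_distrib]
    omega
  | zero => rw [zero_smul, coeff_zero]
  | add a b _ _ h1 h2 => rw [add_smul, coeff_add, h1, h2, add_zero]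
  | smul r a _ h => rw [smul_assoc, coeff_smul, h, mul_zero]

/-- The leading coefficient of `x ^ γ x ^ β • g`, computed in two ways. -/
theorem mulConst_mul_cofactorCoeff (E : SkewPBW R n) (hE : E.IsBijective)
    (hord : IsMonomialOrder n m) {Y : VMon n m} {g : Fin m → A} (hg : E.lm? g = some Y)
    (γ β : Fin n → ℕ) :
    E.mulConst hE γ β * E.cofactorCoeff (Y.shift (γ + β)) g =
      E.twist hE γ (E.cofactorCoeff (Y.shift β) g) * E.mulConst hE γ (Y.shift β).exp := by
  have hg' := ((E.lm?_eq_some_iff g Y).1 hg).2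
  have h1 := E.coeff_stdMonomial_smul_shift hE hord γ
    (E.stdMonomial_smul_mem_supported hE hord β hg')
  rw [cofactorCoeff, cofactorCoeff, E.cofactor_shift hg, E.cofactor_shift hg, ← h1,
    VMon.shift_shift, smul_smul, ← coeff_smul, ← smul_assoc, eq_comm, ← sub_eq_zero, ← coeff_sub,
    ← sub_smul]
  refine E.coeff_smul_eq_zero_of_mem_filt hE hord (E.mulConst_spec hE γ β) hg' ?_
  simp [VMon.shift, Finset.sum_add_distrib]

/-! ### Leading coefficient ideals and the ascending chain condition -/

/-- The left ideal of `R` generated by the leading coefficients of the vectors `x ^ γ • g`, `g ∈ S`,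
with leading monomial `X`. -/
def leadIdeal (E : SkewPBW R n) (S : Set (Fin m → A)) (X : VMon n m) : Submodule R R :=
  Submodule.span R ((fun g => E.cofactorCoeff X g) '' S)

theorem mem_leadIdeal_range (E : SkewPBW R n) (G : Fin t → Fin m → A) (X : VMon n m) (a : R) :
    a ∈ E.leadIdeal (Set.range G) X ↔ ∃ b : Fin t → R, a = ∑ j, b j * E.cofactorCoeff X (G j) := by
  rw [leadIdeal, ← Set.range_comp, Submodule.mem_span_range_iff_exists_fun]
  simp only [smul_eq_mul, Function.comp, eq_comm]

theorem reducible_iff (E : SkewPBW R n) (G : Fin t → Fin m → A) (f : Fin m → A) :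
    E.Reducible G f ↔ ∃ X, E.lm? f = some X ∧ E.coeff f X ∈ E.leadIdeal (Set.range G) X := by
  simp only [Reducible, mem_leadIdeal_range]

/-- `T` contains `S` and an element that is irreducible with respect to `S`. -/
def Enlarges (E : SkewPBW R n) (T S : Set (Fin m → A)) : Prop :=
  S ⊆ T ∧ ∃ p ∈ T, ∃ X, E.lm? p = some X ∧ E.coeff p X ∉ E.leadIdeal S X

/-- A set of vectors cannot be enlarged by irreducible vectors for ever. By Dickson's lemma it may
be assumed that the leading monomials of the new vectors divide each other. Write the leading terms
as `x ^ α ρ` with the coefficient `ρ` on the right: multiplication by `x ^ γ` changes `ρ` by a unit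
factor on the left only, so that the left ideals generated by the first of the `ρ` form an
ascending chain in the Noetherian ring `R`. -/
theorem wellFounded_enlarges (E : SkewPBW R n) (hE : E.IsBijective)
    (hord : IsMonomialOrder n m) [IsNoetherianRing R] :
    WellFounded (E.Enlarges (m := m)) := by
  rw [wellFounded_iff_isEmpty_descending_chain]
  refine ⟨fun ⟨S, hS⟩ => ?_⟩
  choose hsub p hp X hX hnot using hS
  have hmono : Monotone S := monotone_nat_of_le_succ hsub
  obtain ⟨φ, hφ, hdiv⟩ := VMon.exists_divides_subseq X
  let ρ : ℕ → R := fun k => (E.twist hE (X (φ k)).exp).symm (E.coeff (p (φ k)) (X (φ k)))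
  let J : ℕ →o Submodule R R :=
    ⟨fun i => Submodule.span R (ρ '' Set.Iio i),
      fun i j hij => Submodule.span_mono (Set.image_mono (Set.Iio_subset_Iio hij))⟩
  obtain ⟨N, hN⟩ := monotone_stabilizes_iff_noetherian.2 ‹IsNoetherianRing R› J
  have hmem : ρ N ∈ J N := by
    rw [hN (N + 1) (Nat.le_succ N)]
    exact Submodule.subset_span ⟨N, Nat.lt_succ_self N, rfl⟩
  have key : ∀ y ∈ J N, E.twist hE (X (φ N)).exp y ∈ E.leadIdeal (S (φ N)) (X (φ N)) := by
    intro y hy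
    induction hy using Submodule.span_induction with
    | mem y h =>
      obtain ⟨j, hj, rfl⟩ := h
      have hj : j < N := hj
      set γ : Fin n → ℕ := fun i => (X (φ N)).exp i - (X (φ j)).exp i with hγ
      have hshift : (X (φ j)).shift γ = X (φ N) := (hdiv j N hj.le).shift_sub
      have hexp : (X (φ N)).exp = γ + (X (φ j)).exp := by rw [← hshift]; rfl
      have h1 := E.twist_twist hE γ (X (φ j)).exp (ρ j)
      rw [RingEquiv.apply_symm_apply, ← E.cofactorCoeff_shift hE hord (hX (φ j)), hshift,
        ← hexp] at h1
      have h2 : E.twist hE (X (φ N)).exp (ρ j) =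
          ((E.mulConst hE γ (X (φ j)).exp)⁻¹ : Rˣ) • E.cofactorCoeff (X (φ N)) (p (φ j)) := by
        rw [h1, Units.smul_def, smul_eq_mul, Units.inv_mul_cancel_left]
      rw [h2, Units.smul_def]
      refine Submodule.smul_mem _ _ (Submodule.subset_span ⟨_, ?_, rfl⟩)
      exact hmono (Nat.succ_le_of_lt (hφ hj)) (hp (φ j))
    | zero => rw [map_zero]; exact zero_mem _
    | add a b _ _ h1 h2 => rw [map_add]; exact add_mem h1 h2
    | smul r a _ h =>
      rw [smul_eq_mul, map_mul]
      exact Submodule.smul_mem _ _ h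
  have := key _ hmem
  rw [RingEquiv.apply_symm_apply] at this
  exact hnot _ this

/-! ### Combinations with bounded leading monomials -/

/-- The left `R`-module of the combinations of those vectors `x ^ γ • g`, `g ∈ G`, whose leading
monomials lie in `S`. -/
def bounded (E : SkewPBW R n) (G : Set (Fin m → A)) (S : Set (VMon n m)) :
    Submodule R (Fin m → A) :=
  Submodule.span R {f | ∃ g ∈ G, ∃ Y γ, E.lm? g = some Y ∧ Y.shift γ ∈ S ∧
    f = stdMonomial E.x γ • g}

theorem bounded_mono (E : SkewPBW R n) (G : Set (Fin m → A)) {S T : Set (VMon n m)} (h : S ⊆ T) :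
    E.bounded G S ≤ E.bounded G T :=
  Submodule.span_mono fun _ ⟨g, hg, Y, γ, hY, hS, hf⟩ => ⟨g, hg, Y, γ, hY, h hS, hf⟩

theorem bounded_Iic_le_supported (E : SkewPBW R n) (hE : E.IsBijective)
    (hord : IsMonomialOrder n m) (G : Set (Fin m → A)) (X : VMon n m) :
    E.bounded G (Set.Iic X) ≤ E.supported (Set.Iic X) := by
  refine Submodule.span_le.2 ?_
  rintro _ ⟨g, -, Y, γ, hY, hS, rfl⟩
  exact E.supported_mono (Set.Iic_subset_Iic.2 hS)
    (E.stdMonomial_smul_mem_supported hE hord γ ((E.lm?_eq_some_iff g Y).1 hY).2)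

theorem eq_zero_or_mem_bounded_Iic (E : SkewPBW R n) (G : Set (Fin m → A)) {S : Set (VMon n m)}
    {f : Fin m → A} (hf : f ∈ E.bounded G S) : f = 0 ∨ ∃ X ∈ S, f ∈ E.bounded G (Set.Iic X) := by
  induction hf using Submodule.span_induction with
  | mem f h =>
    obtain ⟨g, hg, Y, γ, hY, hS, rfl⟩ := h
    exact Or.inr ⟨_, hS, Submodule.subset_span ⟨g, hg, Y, γ, hY, le_rfl, rfl⟩⟩
  | zero => exact Or.inl rfl
  | add a b _ _ h1 h2 =>
    rcases h1 with rfl | ⟨X, hX, ha⟩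
    · rwa [zero_add]
    rcases h2 with rfl | ⟨Y, hY, hb⟩
    · rw [add_zero]
      exact Or.inr ⟨X, hX, ha⟩
    rcases le_total X Y with h | h
    · exact Or.inr ⟨Y, hY, add_mem (E.bounded_mono G (Set.Iic_subset_Iic.2 h) ha) hb⟩
    · exact Or.inr ⟨X, hX, add_mem ha (E.bounded_mono G (Set.Iic_subset_Iic.2 h) hb)⟩
  | smul r a _ h =>
    rcases h with rfl | ⟨X, hX, ha⟩
    · exact Or.inl (smul_zero r)
    · exact Or.inr ⟨X, hX, Submodule.smul_mem _ _ ha⟩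

theorem smul_mem_bounded_of_mem_filt (E : SkewPBW R n) (hord : IsMonomialOrder n m)
    {G : Set (Fin m → A)} {d : ℕ} {p : A} (hp : p ∈ E.filt d) {g : Fin m → A} (hg : g ∈ G)
    {X Y : VMon n m} (hY : E.lm? g = some Y) (hd : d + ∑ i, Y.exp i ≤ ∑ i, X.exp i) :
    p • g ∈ E.bounded G (Set.Iio X) := by
  induction hp using Submodule.span_induction with
  | mem a h =>
    obtain ⟨β, hβ, rfl⟩ := h
    have hβ : ∑ i, β i < d := hβ
    refine Submodule.subset_span ⟨g, hg, Y, β, hY, hord.lt_of_degree_lt _ _ ?_, rfl⟩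
    simp only [VMon.shift, Pi.add_apply, Finset.sum_add_distrib]
    omega
  | zero => rw [zero_smul]; exact zero_mem _
  | add a b _ _ h1 h2 => rw [add_smul]; exact add_mem h1 h2
  | smul r a _ h => rw [smul_assoc]; exact Submodule.smul_mem _ _ h

theorem stdMonomial_smul_smul_sub_mem_bounded (E : SkewPBW R n) (hE : E.IsBijective)
    (hord : IsMonomialOrder n m) {G : Set (Fin m → A)} {g : Fin m → A} (hg : g ∈ G)
    {Y : VMon n m} (hY : E.lm? g = some Y) (γ β : Fin n → ℕ) (r : R) :
    stdMonomial E.x γ • (r • (stdMonomial E.x β • g)) -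
      (E.twist hE γ r * E.mulConst hE γ β) • (stdMonomial E.x (γ + β) • g) ∈
      E.bounded G (Set.Iio (Y.shift (γ + β))) := by
  rw [← smul_assoc r, smul_smul, ← smul_assoc (E.twist hE γ r * E.mulConst hE γ β : R), ← sub_smul]
  refine E.smul_mem_bounded_of_mem_filt hord (E.stdMonomial_mul_smul hE γ β r) hg hY ?_
  simp [VMon.shift, Finset.sum_add_distrib]

theorem stdMonomial_smul_mem_bounded (E : SkewPBW R n) (hE : E.IsBijective)
    (hord : IsMonomialOrder n m) {G : Set (Fin m → A)} (γ : Fin n → ℕ) {X : VMon n m}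
    {f : Fin m → A} (hf : f ∈ E.bounded G (Set.Iio X)) :
    stdMonomial E.x γ • f ∈ E.bounded G (Set.Iio (X.shift γ)) := by
  induction hf using Submodule.closure_induction with
  | zero => rw [smul_zero]; exact zero_mem _
  | add a b _ _ h1 h2 => rw [smul_add]; exact add_mem h1 h2
  | smul_mem r f h =>
    obtain ⟨g, hg, Y, β, hY, hS, rfl⟩ := h
    have hlt : Y.shift (γ + β) < X.shift γ := by
      rw [← VMon.shift_shift]
      exact hord.shift_lt γ hS
    rw [← sub_add_cancel (stdMonomial E.x γ • (r • (stdMonomial E.x β • g)))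
      ((E.twist hE γ r * E.mulConst hE γ β) • (stdMonomial E.x (γ + β) • g))]
    refine add_mem (E.bounded_mono G (Set.Iio_subset_Iio hlt.le)
      (E.stdMonomial_smul_smul_sub_mem_bounded hE hord hg hY γ β r)) ?_
    exact Submodule.smul_mem _ _ (Submodule.subset_span ⟨g, hg, Y, _, hY, hlt, rfl⟩)

theorem mem_bounded_univ (E : SkewPBW R n) {G : Set (Fin m → A)} {f : Fin m → A}
    (hf : f ∈ Submodule.span A G) : f ∈ E.bounded G Set.univ := by
  induction hf using Submodule.closure_induction with
  | zero => exact zero_mem _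
  | add a b _ _ h1 h2 => exact add_mem h1 h2
  | smul_mem a g h =>
    cases hY : E.lm? g with
    | none =>
      rw [(E.lm?_eq_none_iff g).1 hY, smul_zero]
      exact zero_mem _
    | some Y =>
      rw [← E.sum_coord_smul a, Finset.sum_smul]
      refine Submodule.sum_mem _ fun α _ => ?_
      rw [smul_assoc]
      exact Submodule.smul_mem _ _ (Submodule.subset_span ⟨g, h, Y, α, hY, trivial, rfl⟩)

theorem cofactor_smul_mem_bounded (E : SkewPBW R n) {G : Set (Fin m → A)} {g : Fin m → A}
    (hg : g ∈ G) {X : VMon n m} {S : Set (VMon n m)} (hX : X ∈ S) :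
    E.cofactor X g • g ∈ E.bounded G S := by
  rcases E.cofactor_eq_zero_or X g with ⟨h, -⟩ | ⟨Y, γ, hY, rfl, h⟩
  · rw [h, zero_smul]
    exact zero_mem _
  · rw [h]
    exact Submodule.subset_span ⟨g, hg, Y, γ, hY, hX, rfl⟩

end SkewPBW

/-! ### Programs -/

theorem PFun.exists_mem_fix {α β : Type*} {r : α → α → Prop} (hr : WellFounded r)
    (f : α →. β ⊕ α) (P : α → Prop) (Q : β → Prop)
    (h : ∀ a, P a → (∃ b, Sum.inl b ∈ f a ∧ Q b) ∨ ∃ a', Sum.inr a' ∈ f a ∧ r a' a ∧ P a')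
    {a : α} (ha : P a) : ∃ b ∈ f.fix a, Q b := by
  induction a using hr.induction with
  | _ a ih =>
    rcases h a ha with ⟨b, hb, hQ⟩ | ⟨a', ha', hlt, hP⟩
    · exact ⟨b, PFun.fix_stop hb, hQ⟩
    · obtain ⟨b, hb, hQ⟩ := ih a' hlt hP
      exact ⟨b, PFun.mem_fix_iff.2 (Or.inr ⟨a', ha', hb⟩), hQ⟩

theorem mem_runAll {k : ℕ} {β : Type*} {p : Fin k → Part β} {b : Fin k → β}
    (h : ∀ i, b i ∈ p i) : b ∈ runAll p :=
  ⟨fun i => (h i).1, funext fun i => (h i).2⟩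

namespace SkewPBW

variable {A : Type*} [Ring A] {R : Subring A} {n m r s t : ℕ}

theorem coe_mul_smul (b : R) (a : A) (f : Fin m → A) : ((b : A) * a) • f = b • (a • f) :=
  mul_smul (b : A) a f

/-! ### The division algorithm -/

section Division

variable [LinearOrder (VMon n m)]

/-- The leading monomial, with the value `⊥` for the zero vector. -/
def lmBot (E : SkewPBW R n) (f : Fin m → A) : WithBot (VMon n m) :=
  (E.lm? f).elim ⊥ fun X => (X : WithBot (VMon n m))

theorem lmBot_lt (E : SkewPBW R n) {f g : Fin m → A} {X : VMon n m} (hf : E.lm? f = some X)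
    (hg : g ∈ E.supported (Set.Iio X)) : E.lmBot g < E.lmBot f := by
  rw [lmBot, lmBot, hf]
  cases hY : E.lm? g with
  | none => exact WithBot.bot_lt_coe X
  | some Y =>
    refine WithBot.coe_lt_coe.2 ?_
    by_contra hcon
    exact ((E.lm?_eq_some_iff g Y).1 hY).1 (hg Y hcon)

theorem sum_smul_cofactor_mem_supported (E : SkewPBW R n) (hE : E.IsBijective)
    (hord : IsMonomialOrder n m) (G : Fin t → Fin m → A) (X : VMon n m) (b : Fin t → R) :
    ∑ j, ((b j : A) * E.cofactor X (G j)) • G j ∈ E.supported (Set.Iic X) := by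
  refine Submodule.sum_mem _ fun j _ => ?_
  rw [coe_mul_smul]
  exact Submodule.smul_mem _ _ (E.cofactor_smul_mem_supported hE hord X (G j))

theorem coeff_sum_smul_cofactor (E : SkewPBW R n) (G : Fin t → Fin m → A) (X : VMon n m)
    (b : Fin t → R) : E.coeff (∑ j, ((b j : A) * E.cofactor X (G j)) • G j) X =
      ∑ j, b j * E.cofactorCoeff X (G j) := by
  rw [coeff_sum]
  refine Finset.sum_congr rfl fun j _ => ?_
  rw [coe_mul_smul, coeff_smul, cofactorCoeff]

theorem sum_smul_cofactor_mem_bounded (E : SkewPBW R n) (G : Fin t → Fin m → A) {X : VMon n m}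
    {S : Set (VMon n m)} (hX : X ∈ S) (b : Fin t → R) :
    ∑ j, ((b j : A) * E.cofactor X (G j)) • G j ∈ E.bounded (Set.range G) S := by
  refine Submodule.sum_mem _ fun j _ => ?_
  rw [coe_mul_smul]
  exact Submodule.smul_mem _ _ (E.cofactor_smul_mem_bounded (Set.mem_range_self j) hX)

/-- The division algorithm ends, because the leading monomial of the vector still to be divided
decreases in every pass of the loop. The remainder is zero or irreducible, and the part of the
result formed by the quotients has no larger leading monomials than the given vector. -/
theorem divide_spec (E : SkewPBW R n) (hE : E.IsBijective) (hord : IsMonomialOrder n m)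
    (lgs : LeftGroebnerSoluble R) (G : Fin t → Fin m → A) (f : Fin m → A) :
    ∃ d ∈ E.divide lgs G f, f = ∑ j, d.1 j • G j + d.2 ∧
      (∀ X, E.lm? d.2 = some X → E.coeff d.2 X ∉ E.leadIdeal (Set.range G) X) ∧
      ∀ X, f ∈ E.supported (Set.Iio X) →
        ∑ j, d.1 j • G j ∈ E.bounded (Set.range G) (Set.Iio X) := by
  have := hord.wellFoundedLT
  refine PFun.exists_mem_fix
    (r := InvImage (· < ·) fun S : DivState A m t => E.lmBot S.h) (InvImage.wf _ wellFounded_lt)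
    (E.divStep lgs G)
    -- the invariant of the loop: the terms of the remainder are irreducible and lie above those
    -- of `h`, and the bound on `f` is inherited by `h` and by the part formed by the quotients
    (fun S => f = S.h + ∑ j, S.quot j • G j + S.rem ∧
      (∀ X, E.coeff S.rem X ≠ 0 →
        E.coeff S.rem X ∉ E.leadIdeal (Set.range G) X ∧ S.h ∈ E.supported (Set.Iio X)) ∧
      ∀ X, f ∈ E.supported (Set.Iio X) → S.h ∈ E.supported (Set.Iio X) ∧
        ∑ j, S.quot j • G j ∈ E.bounded (Set.range G) (Set.Iio X)) _ ?_ ?_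
  · rintro ⟨h, q, ρ⟩ ⟨h1, h2, h3⟩
    simp only at h1 h2 h3
    cases hX : E.lm? h with
    | none =>
      refine Or.inl ⟨(q, ρ), by simp only [divStep, hX, Part.mem_some_iff], ?_, ?_, ?_⟩
      · rw [(E.lm?_eq_none_iff h).1 hX, zero_add] at h1
        exact h1
      · exact fun X hX => (h2 X ((E.lm?_eq_some_iff ρ X).1 hX).1).1
      · exact fun X hf => (h3 X hf).2
    | some X =>
      have hlm := (E.lm?_eq_some_iff h X).1 hX
      have hlt : ∀ Z, h ∈ E.supported (Set.Iio Z) → X < Z := fun Z hZ => by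
        by_contra hcon
        exact hlm.1 (hZ X hcon)
      right
      cases hb : lgs.solve (E.coeff h X) (fun j => E.cofactorCoeff X (G j)) with
      | some b =>
        have hsub : h - ∑ j, ((b j : A) * E.cofactor X (G j)) • G j ∈ E.supported (Set.Iio X) := by
          refine E.mem_supported_Iio (sub_mem hlm.2
            (E.sum_smul_cofactor_mem_supported hE hord G X b)) ?_
          rw [coeff_sub, coeff_sum_smul_cofactor, sub_eq_zero]
          exact lgs.solve_some _ _ _ hb
        refine ⟨⟨h - ∑ j, ((b j : A) * E.cofactor X (G j)) • G j,
          q + fun j => (b j : A) * E.cofactor X (G j), ρ⟩,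
          by simp only [divStep, hX, hb, Part.mem_some_iff], E.lmBot_lt hX hsub, ?_, ?_, ?_⟩
        · simp only [Pi.add_apply, add_smul, Finset.sum_add_distrib]
          rw [h1]
          abel
        · exact fun Z hZ => ⟨(h2 Z hZ).1,
            E.supported_mono (Set.Iio_subset_Iio (hlt Z (h2 Z hZ).2).le) hsub⟩
        · intro Z hZ
          have hXZ := hlt Z (h3 Z hZ).1
          refine ⟨E.supported_mono (Set.Iio_subset_Iio hXZ.le) hsub, ?_⟩
          simp only [Pi.add_apply, add_smul, Finset.sum_add_distrib]
          exact add_mem (h3 Z hZ).2 (E.sum_smul_cofactor_mem_bounded G (Set.mem_Iio.2 hXZ) b)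
      | none =>
        set lt : Fin m → A :=
          Pi.single X.idx ((E.coeff h X : A) * stdMonomial E.x X.exp) with hlt_def
        have hlc : ∀ Y, E.coeff lt Y = if Y = X then E.coeff h X else 0 := fun Y =>
          E.coeff_single X Y _
        have hsub : h - lt ∈ E.supported (Set.Iio X) := by
          intro Y hY
          rw [coeff_sub, hlc]
          split_ifs with hYX
          · rw [hYX, sub_self]
          · rw [sub_zero]
            exact hlm.2 Y (not_le.2 (lt_of_le_of_ne (not_lt.1 hY) (Ne.symm hYX)))
        refine ⟨⟨h - lt, q, ρ + lt⟩, by simp only [divStep, hX, hb, Part.mem_some_iff, hlt_def],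
          E.lmBot_lt hX hsub, ?_, ?_, ?_⟩
        · simp only
          rw [h1]
          abel
        · intro Z hZ
          simp only [coeff_add, hlc] at hZ ⊢
          by_cases hZX : Z = X
          · subst hZX
            -- the monomials of the remainder are larger than those of `h`
            have hρ : E.coeff ρ Z = 0 := by
              by_contra hcon
              exact lt_irrefl _ (hlt Z (h2 Z hcon).2)
            rw [if_pos rfl, hρ, zero_add]
            refine ⟨fun hmem => ?_, hsub⟩
            obtain ⟨b, hb'⟩ := (E.mem_leadIdeal_range G Z _).1 hmem
            exact lgs.solve_none _ _ hb b hb'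
          · rw [if_neg hZX, add_zero] at hZ ⊢
            exact ⟨(h2 Z hZ).1, E.supported_mono (Set.Iio_subset_Iio (hlt Z (h2 Z hZ).2).le) hsub⟩
        · intro Z hZ
          exact ⟨E.supported_mono (Set.Iio_subset_Iio (hlt Z (h3 Z hZ).1).le) hsub, (h3 Z hZ).2⟩
  · refine ⟨by simp, fun X hX => absurd (E.coeff_zero X) hX, fun X hf => ⟨hf, ?_⟩⟩
    simp only [Pi.zero_apply, zero_smul, Finset.sum_const_zero]
    exact zero_mem _

/-- Division by a Gröbner basis decides membership. -/
theorem IsGroebnerBasis.divide_spec {E : SkewPBW R n} {G : Fin t → Fin m → A}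
    {M : Submodule A (Fin m → A)} (hG : E.IsGroebnerBasis G M) (hE : E.IsBijective)
    (hord : IsMonomialOrder n m) (lgs : LeftGroebnerSoluble R) (f : Fin m → A) :
    ∃ d ∈ E.divide lgs G f, f = ∑ j, d.1 j • G j + d.2 ∧ (d.2 = 0 ↔ f ∈ M) := by
  obtain ⟨d, hd, hf, hirr, -⟩ := E.divide_spec hE hord lgs G f
  have hsum : ∑ j, d.1 j • G j ∈ M :=
    Submodule.sum_mem _ fun j _ => Submodule.smul_mem _ _ (hG.1 j).1
  refine ⟨d, hd, hf, fun h0 => ?_, fun hfM => ?_⟩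
  · rw [hf, h0, add_zero]
    exact hsum
  · by_contra hne
    have hrem : d.2 ∈ M := by
      have : d.2 = f - ∑ j, d.1 j • G j := by rw [eq_sub_iff_add_eq', ← hf]
      rw [this]
      exact sub_mem hfM hsum
    obtain ⟨X, hX, hmem⟩ := (E.reducible_iff G d.2).1 (hG.2 _ hrem hne)
    exact hirr X hX hmem

/-- A Hilbert basis theorem: an enlargement of a finite subset of a submodule by irreducible
vectors cannot go on for ever, and when it is not possible, division shows that
the subset generates. -/
theorem isNoetherian_vectors (E : SkewPBW R n) (hE : E.IsBijective) (hord : IsMonomialOrder n m)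
    (lgs : LeftGroebnerSoluble R) : IsNoetherian A (Fin m → A) := by
  have := lgs.noetherian
  refine ⟨fun M => ?_⟩
  obtain ⟨S, ⟨hfin, hSM⟩, hmin⟩ := (E.wellFounded_enlarges hE hord).has_min
    {S : Set (Fin m → A) | S.Finite ∧ S ⊆ M} ⟨∅, Set.finite_empty, Set.empty_subset _⟩
  obtain ⟨k, G, hG⟩ := hfin.fin_embedding
  refine ⟨hfin.toFinset, le_antisymm ?_ fun f hf => ?_⟩
  · rw [Set.Finite.coe_toFinset, Submodule.span_le]
    exact hSM
  · rw [Set.Finite.coe_toFinset]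
    obtain ⟨d, -, hd, hirr, -⟩ := E.divide_spec hE hord lgs G f
    have hsum : ∑ j, d.1 j • G j ∈ Submodule.span A S := by
      refine Submodule.sum_mem _ fun j _ => Submodule.smul_mem _ _ (Submodule.subset_span ?_)
      rw [← hG]
      exact ⟨j, rfl⟩
    cases hX : E.lm? d.2 with
    | none =>
      rw [hd, (E.lm?_eq_none_iff d.2).1 hX, add_zero]
      exact hsum
    | some X =>
      have hrem : d.2 ∈ M := by
        have : d.2 = f - ∑ j, d.1 j • G j := by rw [eq_sub_iff_add_eq', ← hd]
        rw [this]
        exact sub_mem hf (Submodule.span_le.2 hSM hsum)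
      refine absurd ⟨Set.subset_insert _ _, d.2, Set.mem_insert _ _, X, hX, ?_⟩
        (hmin (insert d.2 S) ⟨hfin.insert _, Set.insert_subset hrem hSM⟩)
      rw [← hG]
      exact hirr X hX

end Division

/-! ### Buchberger's criterion -/

section Criterion

variable [LinearOrder (VMon n m)]

theorem exists_mem_lcms (E : SkewPBW R n) (G : Fin t → Fin m → A) {X : VMon n m}
    (h : ∃ j Y, E.lm? (G j) = some Y ∧ Y.Divides X) :
    ∃ Z ∈ E.lcms G, Z.Divides X ∧
      ∀ j Y, E.lm? (G j) = some Y → Y.Divides X → Y.Divides Z := by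
  classical
  set J : List (Fin t) := (List.finRange t).filter
    fun j => decide (∃ Y, E.lm? (G j) = some Y ∧ Y.Divides X) with hJ
  have hmem : ∀ Y, Y ∈ J.filterMap (fun j => E.lm? (G j)) ↔
      ∃ j, E.lm? (G j) = some Y ∧ Y.Divides X := by
    intro Y
    rw [List.mem_filterMap]
    constructor
    · rintro ⟨j, hj, hY⟩
      obtain ⟨Y', hY', hd⟩ := of_decide_eq_true (List.mem_filter.1 hj).2
      rw [hY, Option.some.injEq] at hY'
      exact ⟨j, hY, hY' ▸ hd⟩
    · rintro ⟨j, hY, hd⟩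
      exact ⟨j, List.mem_filter.2 ⟨List.mem_finRange j, decide_eq_true ⟨Y, hY, hd⟩⟩, hY⟩
  obtain ⟨j, Y, hY, hd⟩ := h
  obtain ⟨Z, hZ, hZX, hdiv⟩ := VMon.lcm?_spec (X := X)
    (List.ne_nil_of_mem ((hmem Y).2 ⟨j, hY, hd⟩))
    (fun W hW => ((hmem W).1 hW).choose_spec.2)
  exact ⟨Z, List.mem_filterMap.2 ⟨J, List.mem_sublists.2 List.filter_sublist, hZ⟩, hZX,
    fun j Y hY hd => hdiv Y ((hmem Y).2 ⟨j, hY, hd⟩)⟩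

/-- If the S-vectors are combinations with smaller leading monomials, then so is every combination
`∑ bⱼ x ^ γⱼ • G j` at a monomial `X` whose leading terms cancel: let `Z` be the least common
multiple of those leading monomials of `G` that divide `X`. Up to smaller
terms, the combination is the multiple by `x ^ γ`, `γ = X - Z`, of a combination at `Z` whose
leading terms cancel, and this is a left linear combination of S-vectors. -/
theorem sum_smul_cofactor_mem_bounded_of_syzygy (E : SkewPBW R n) (hE : E.IsBijective)
    (hord : IsMonomialOrder n m) (lgs : LeftGroebnerSoluble R) (G : Fin t → Fin m → A)
    (hS : ∀ Z ∈ E.lcms G, ∀ d ∈ lgs.syz (fun j => E.cofactorCoeff Z (G j)),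
      ∑ j, ((d j : A) * E.cofactor Z (G j)) • G j ∈ E.bounded (Set.range G) (Set.Iio Z))
    (X : VMon n m) (b : Fin t → R) (hb : ∑ j, b j * E.cofactorCoeff X (G j) = 0) :
    ∑ j, ((b j : A) * E.cofactor X (G j)) • G j ∈ E.bounded (Set.range G) (Set.Iio X) := by
  by_cases hex : ∃ j Y, E.lm? (G j) = some Y ∧ Y.Divides X
  swap
  · refine Submodule.sum_mem _ fun j _ => ?_
    rcases E.cofactor_eq_zero_or X (G j) with ⟨h, -⟩ | ⟨Y, γ, hY, rfl, h⟩
    · rw [h, mul_zero, zero_smul]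
      exact zero_mem _
    · exact absurd ⟨j, Y, hY, VMon.divides_shift γ Y⟩ hex
  obtain ⟨Z, hZ, hZX, hdiv⟩ := E.exists_mem_lcms G hex
  set γ : Fin n → ℕ := fun i => X.exp i - Z.exp i with hγ
  have hX : Z.shift γ = X := hZX.shift_sub
  have hall : ∀ d : Fin t → R, ∑ j, d j * E.cofactorCoeff Z (G j) = 0 →
      ∑ j, ((d j : A) * E.cofactor Z (G j)) • G j ∈ E.bounded (Set.range G) (Set.Iio Z) := by
    intro d hd
    rw [← lgs.syz_spec] at hd
    induction hd using Submodule.span_induction with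
    | mem d h => exact hS Z hZ d h
    | zero =>
      simp only [Pi.zero_apply, ZeroMemClass.coe_zero, zero_mul, zero_smul, Finset.sum_const_zero]
      exact zero_mem _
    | add a b _ _ h1 h2 =>
      simp only [Pi.add_apply, Subring.coe_add, add_mul, add_smul, Finset.sum_add_distrib]
      exact add_mem h1 h2
    | smul r a _ h =>
      simp only [coe_mul_smul, Pi.smul_apply, smul_eq_mul, mul_smul r, ← Finset.smul_sum] at h ⊢
      exact Submodule.smul_mem _ _ h
  -- for each `j` the unit which compares `x ^ γ x ^ β` with the cofactor of `G j` at `X`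
  have hu : ∀ j, ∃ u : Rˣ,
      (u : R) * E.cofactorCoeff X (G j) =
        E.twist hE γ (E.cofactorCoeff Z (G j)) * E.mulConst hE γ Z.exp ∧
      ∀ r : R, stdMonomial E.x γ • (r • (E.cofactor Z (G j) • G j)) -
        (E.twist hE γ r * u) • (E.cofactor X (G j) • G j) ∈
          E.bounded (Set.range G) (Set.Iio X) := by
    intro j
    rcases E.cofactor_eq_zero_or Z (G j) with ⟨h, hno⟩ | ⟨Y, β, hY, hβ, h⟩
    · have hX0 : E.cofactor X (G j) = 0 := by
        rcases E.cofactor_eq_zero_or X (G j) with ⟨h', -⟩ | ⟨Y, β, hY, hβ, -⟩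
        · exact h'
        · exact absurd ⟨Y, hY, hdiv j Y hY (hβ ▸ VMon.divides_shift β Y)⟩ hno
      refine ⟨1, ?_, fun r => ?_⟩
      · rw [cofactorCoeff, cofactorCoeff, h, hX0, zero_smul, coeff_zero, coeff_zero, map_zero,
          mul_zero, zero_mul]
      · rw [h, hX0, zero_smul, smul_zero, smul_zero, smul_zero, sub_zero]
        exact zero_mem _
    · have hYX : Y.shift (γ + β) = X := by rw [← VMon.shift_shift, hβ, hX]
      have hcX : E.cofactor X (G j) = stdMonomial E.x (γ + β) := by
        rw [← hYX, E.cofactor_shift hY]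
      refine ⟨E.mulConst hE γ β, ?_, fun r => ?_⟩
      · have := E.mulConst_mul_cofactorCoeff hE hord hY γ β
        rwa [hYX, hβ] at this
      · have := E.stdMonomial_smul_smul_sub_mem_bounded hE hord (G := Set.range G) ⟨j, rfl⟩ hY γ β r
        rwa [hYX, ← hcX, ← h] at this
  choose u hu1 hu2 using hu
  set d : Fin t → R := fun j => (E.twist hE γ).symm (b j * ((u j)⁻¹ : Rˣ)) with hd_def
  have hd : ∑ j, d j * E.cofactorCoeff Z (G j) = 0 := by
    refine (E.twist hE γ).injective ?_
    rw [map_zero, ← (E.mulConst hE γ Z.exp).mul_left_eq_zero, map_sum, Finset.sum_mul, ← hb]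
    refine Finset.sum_congr rfl fun j _ => ?_
    rw [map_mul, hd_def, RingEquiv.apply_symm_apply, mul_assoc, ← hu1, mul_assoc,
      Units.inv_mul_cancel_left]
  have h1 := E.stdMonomial_smul_mem_bounded hE hord γ (hall d hd)
  rw [hX, Finset.smul_sum] at h1
  have h2 : ∑ j, (stdMonomial E.x γ • (d j • (E.cofactor Z (G j) • G j)) -
        (E.twist hE γ (d j) * u j) • (E.cofactor X (G j) • G j)) ∈
          E.bounded (Set.range G) (Set.Iio X) :=
    Submodule.sum_mem _ fun j _ => hu2 j (d j)
  have h3 : ∀ j, E.twist hE γ (d j) * u j = b j := fun j => by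
    rw [hd_def, RingEquiv.apply_symm_apply, Units.inv_mul_cancel_right]
  simp only [h3, Finset.sum_sub_distrib] at h2
  simp only [coe_mul_smul] at h1 ⊢
  exact (Submodule.sub_mem_iff_right _ h1).1 h2

theorem exists_eq_add_sum_of_mem_bounded_Iic (E : SkewPBW R n) (G : Fin t → Fin m → A)
    {X : VMon n m} {f : Fin m → A} (hf : f ∈ E.bounded (Set.range G) (Set.Iic X)) :
    ∃ v ∈ E.bounded (Set.range G) (Set.Iio X), ∃ b : Fin t → R,
      f = v + ∑ j, ((b j : A) * E.cofactor X (G j)) • G j := by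
  simp only [coe_mul_smul]
  induction hf using Submodule.span_induction with
  | mem f h =>
    obtain ⟨_, ⟨j, rfl⟩, Y, γ, hY, hS, rfl⟩ := h
    rcases (Set.mem_Iic.1 hS).lt_or_eq with hlt | rfl
    · exact ⟨_, Submodule.subset_span ⟨_, ⟨j, rfl⟩, Y, γ, hY, hlt, rfl⟩, 0, by simp⟩
    · refine ⟨0, zero_mem _, Pi.single j 1, ?_⟩
      rw [zero_add, Finset.sum_eq_single j (fun i _ hi => by rw [Pi.single_eq_of_ne hi, zero_smul])
        (fun h => absurd (Finset.mem_univ j) h), Pi.single_eq_same, one_smul,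
        E.cofactor_shift hY]
  | zero => exact ⟨0, zero_mem _, 0, by simp⟩
  | add f g _ _ h1 h2 =>
    obtain ⟨v, hv, b, rfl⟩ := h1
    obtain ⟨w, hw, c, rfl⟩ := h2
    refine ⟨v + w, add_mem hv hw, b + c, ?_⟩
    simp only [Pi.add_apply, add_smul, Finset.sum_add_distrib]
    abel
  | smul r f _ h =>
    obtain ⟨v, hv, b, rfl⟩ := h
    refine ⟨r • v, Submodule.smul_mem _ _ hv, r • b, ?_⟩
    simp only [Pi.smul_apply, smul_eq_mul, mul_smul r, smul_add, Finset.smul_sum]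

/-- Buchberger's criterion. A nonzero `f` in the module is written as a combination whose largest
leading monomial `X` is as small as possible. If the leading terms at `X` do not cancel,
then `f` is reducible; if they do, the part at `X` can be rewritten with smaller monomials. -/
theorem reducible_of_mem_bounded (E : SkewPBW R n) (hE : E.IsBijective)
    (hord : IsMonomialOrder n m) (lgs : LeftGroebnerSoluble R) (G : Fin t → Fin m → A)
    (hS : ∀ Z ∈ E.lcms G, ∀ d ∈ lgs.syz (fun j => E.cofactorCoeff Z (G j)),
      ∑ j, ((d j : A) * E.cofactor Z (G j)) • G j ∈ E.bounded (Set.range G) (Set.Iio Z))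
    (X : VMon n m) {f : Fin m → A} (hf : f ∈ E.bounded (Set.range G) (Set.Iic X)) (hf0 : f ≠ 0) :
    E.Reducible G f := by
  have := hord.wellFoundedLT
  induction X using WellFoundedLT.induction generalizing f with
  | ind X ih =>
    obtain ⟨v, hv, b, hfv⟩ := E.exists_eq_add_sum_of_mem_bounded_Iic G hf
    have hsupp : ∀ w ∈ E.bounded (Set.range G) (Set.Iio X), E.coeff w X = 0 := by
      intro w hw
      rcases E.eq_zero_or_mem_bounded_Iic _ hw with rfl | ⟨Y, hY, hw⟩
      · exact E.coeff_zero X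
      · exact E.bounded_Iic_le_supported hE hord _ Y hw X (not_le.2 hY)
    have hcoeff : E.coeff f X = ∑ j, b j * E.cofactorCoeff X (G j) := by
      rw [hfv, coeff_add, hsupp v hv, zero_add, coeff_sum_smul_cofactor]
    by_cases h0 : E.coeff f X = 0
    · have hf' : f ∈ E.bounded (Set.range G) (Set.Iio X) := by
        rw [hfv]
        exact add_mem hv (E.sum_smul_cofactor_mem_bounded_of_syzygy hE hord lgs G hS X b
          (hcoeff ▸ h0))
      rcases E.eq_zero_or_mem_bounded_Iic _ hf' with h | ⟨Y, hY, hfY⟩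
      · exact absurd h hf0
      · exact ih Y hY hfY hf0
    · exact ⟨X, (E.lm?_eq_some_iff f X).2
        ⟨h0, E.bounded_Iic_le_supported hE hord _ X hf⟩, b, hcoeff⟩

theorem isGroebnerBasis_span (E : SkewPBW R n) (hE : E.IsBijective)
    (hord : IsMonomialOrder n m) (lgs : LeftGroebnerSoluble R) (G : Fin t → Fin m → A)
    (hG : ∀ j, G j ≠ 0)
    (hS : ∀ Z ∈ E.lcms G, ∀ d ∈ lgs.syz (fun j => E.cofactorCoeff Z (G j)),
      ∑ j, ((d j : A) * E.cofactor Z (G j)) • G j ∈ E.bounded (Set.range G) (Set.Iio Z)) :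
    E.IsGroebnerBasis G (Submodule.span A (Set.range G)) := by
  refine ⟨fun j => ⟨Submodule.subset_span ⟨j, rfl⟩, hG j⟩, fun f hf hf0 => ?_⟩
  rcases E.eq_zero_or_mem_bounded_Iic _ (E.mem_bounded_univ hf) with h | ⟨X, -, hX⟩
  · exact absurd h hf0
  · exact E.reducible_of_mem_bounded hE hord lgs G hS X hX hf0

end Criterion

/-! ### Buchberger's algorithm -/

theorem mem_range_vecs {C : Type*} (B : Tracked C r s) (v : Fin s → C) :
    v ∈ Set.range B.vecs ↔ ∃ p ∈ B, p.1 = v := by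
  constructor
  · rintro ⟨j, rfl⟩
    exact ⟨B.get j, List.get_mem B j, rfl⟩
  · rintro ⟨p, hp, rfl⟩
    obtain ⟨j, rfl⟩ := List.mem_iff_get.1 hp
    exact ⟨j, rfl⟩

/-- Buchberger's algorithm ends: a pass that does not end the loop appends a nonzero remainder, which
is irreducible, so it enlarges the list. All members of the list stay nonzero and expressed
through the rows of `F`, and the rows stay in the module that the list generates. -/
theorem buchberger_spec [DecidableEq A] [LinearOrder (VMon n s)] (E : SkewPBW R n)
    (hE : E.IsBijective) (hord : IsMonomialOrder n s) (lgs : LeftGroebnerSoluble R)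
    (F : Matrix (Fin r) (Fin s) A) :
    ∃ B ∈ E.buchberger lgs F, E.IsGroebnerBasis B.vecs (rowModule F) ∧
      B.G.transpose = B.H.transpose * F := by
  have := lgs.noetherian
  refine PFun.exists_mem_fix (r := InvImage E.Enlarges fun B : Tracked A r s => Set.range B.vecs)
    (InvImage.wf _ (E.wellFounded_enlarges hE hord)) (E.buchbergerStep lgs)
    (fun B => (∀ p ∈ B, p.1 ≠ 0 ∧ p.1 = ∑ i, p.2 i • F i) ∧
      ∀ i, F i ∈ Submodule.span A (Set.range B.vecs)) _ ?_ ?_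
  · rintro B ⟨h1, h2⟩
    set fam := E.sFamilies lgs B.vecs with hfam
    have hdiv : ∀ k : Fin fam.length, _ := fun k =>
      E.divide_spec hE hord lgs B.vecs (∑ j, fam.get k j • B.vecs j)
    choose d hd hsum hirr hbdd using hdiv
    set rems : Fin fam.length → (Fin s → A) × (Fin r → A) := fun k =>
      ((d k).2, ∑ j, (fam.get k j - (d k).1 j) • (B.get j).2) with hrems
    set new := (List.ofFn rems).filter fun p => p.1 ≠ 0 with hnew
    have hstep : (if new = [] then Sum.inl B else Sum.inr (B ++ new)) ∈ E.buchbergerStep lgs B :=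
      Part.mem_map _ (mem_runAll fun k => Part.mem_map _ (hd k))
    by_cases hnil : new = []
    · rw [if_pos hnil] at hstep
      refine Or.inl ⟨B, hstep, ?_, ?_⟩
      · have hrow : rowModule F = Submodule.span A (Set.range B.vecs) := by
          refine le_antisymm (Submodule.span_le.2 ?_) (Submodule.span_le.2 ?_)
          · rintro _ ⟨i, rfl⟩
            exact h2 i
          · rintro _ ⟨j, rfl⟩
            rw [Tracked.vecs, (h1 _ (List.get_mem B j)).2]
            exact Submodule.sum_mem _ fun i _ =>
              Submodule.smul_mem _ _ (Submodule.subset_span ⟨i, rfl⟩)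
        rw [hrow]
        refine E.isGroebnerBasis_span hE hord lgs B.vecs
          (fun j => (h1 _ (List.get_mem B j)).1) fun Z hZ c hc => ?_
        have hmem : (fun j => (c j : A) * E.cofactor Z (B.vecs j)) ∈ fam :=
          List.mem_flatMap.2 ⟨Z, hZ, List.mem_map.2 ⟨c, hc, rfl⟩⟩
        obtain ⟨k, hk⟩ := List.mem_iff_get.1 hmem
        have hrem : (d k).2 = 0 := by
          by_contra hne
          have : rems k ∈ new :=
            List.mem_filter.2 ⟨(List.mem_ofFn' rems _).2 ⟨k, rfl⟩, decide_eq_true hne⟩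
          rw [hnil] at this
          exact List.not_mem_nil this
        have hsyz : ∑ j, c j * E.cofactorCoeff Z (B.vecs j) = 0 :=
          (lgs.syz_spec _ _).1 (Submodule.subset_span hc)
        have hk' := hsum k
        have hb := hbdd k Z
        rw [hrem, add_zero] at hk'
        rw [← hk', hk] at hb
        refine hb (E.mem_supported_Iio (E.sum_smul_cofactor_mem_supported hE hord B.vecs Z c) ?_)
        rw [coeff_sum_smul_cofactor, hsyz]
      · refine Matrix.ext fun j k => ?_
        have := congrFun (h1 _ (List.get_mem B j)).2 k
        simpa [Matrix.mul_apply, Tracked.G, Tracked.H] using this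
    · rw [if_neg hnil] at hstep
      have hmono : Set.range B.vecs ⊆ Set.range (Tracked.vecs (B ++ new)) := by
        intro v hv
        rw [mem_range_vecs] at hv ⊢
        obtain ⟨p, hp, hv⟩ := hv
        exact ⟨p, List.mem_append_left _ hp, hv⟩
      have hnew' : ∀ p ∈ new, p.1 ≠ 0 ∧ ∃ k, p = rems k := by
        intro p hp
        obtain ⟨hp1, hp2⟩ := List.mem_filter.1 hp
        obtain ⟨k, hk⟩ := (List.mem_ofFn' rems _).1 hp1
        exact ⟨of_decide_eq_true hp2, k, hk.symm⟩
      refine Or.inr ⟨B ++ new, hstep, ⟨hmono, ?_⟩, ?_, fun i => Submodule.span_mono hmono (h2 i)⟩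
      · obtain ⟨p, hp⟩ := List.exists_mem_of_ne_nil new hnil
        obtain ⟨hp0, k, rfl⟩ := hnew' p hp
        cases hX : E.lm? (rems k).1 with
        | none => exact absurd ((E.lm?_eq_none_iff _).1 hX) hp0
        | some X =>
          exact ⟨_, (mem_range_vecs _ _).2 ⟨_, List.mem_append_right _ hp, rfl⟩, X, hX,
            hirr k X hX⟩
      · intro p hp
        rcases List.mem_append.1 hp with hp | hp
        · exact h1 p hp
        obtain ⟨hp0, k, rfl⟩ := hnew' p hp
        refine ⟨hp0, ?_⟩
        have hrem : (d k).2 = ∑ j, (fam.get k j - (d k).1 j) • B.vecs j := by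
          simp only [sub_smul, Finset.sum_sub_distrib]
          rw [eq_sub_iff_add_eq', ← hsum k]
        have hvec : ∀ j, B.vecs j = ∑ i, (B.get j).2 i • F i := fun j =>
          (h1 _ (List.get_mem B j)).2
        simp only [hrems]
        rw [hrem]
        simp only [Finset.sum_apply, Pi.smul_apply, smul_eq_mul, Finset.sum_smul, mul_smul]
        rw [Finset.sum_comm]
        refine Finset.sum_congr rfl fun j _ => ?_
        rw [hvec j, Finset.smul_sum]
  · constructor
    · intro p hp
      obtain ⟨hp1, hp2⟩ := List.mem_filter.1 hp
      obtain ⟨i, rfl⟩ := (List.mem_ofFn' _ _).1 hp1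
      refine ⟨of_decide_eq_true hp2, ?_⟩
      simp only
      rw [Finset.sum_eq_single i (fun j _ hj => by rw [Pi.single_eq_of_ne hj, zero_smul])
        (fun h => absurd (Finset.mem_univ i) h), Pi.single_eq_same, one_smul]
    · intro i
      by_cases h0 : F i = 0
      · rw [h0]
        exact zero_mem _
      · refine Submodule.subset_span ((mem_range_vecs _ _).2 ⟨(F i, Pi.single i 1), ?_, rfl⟩)
        exact List.mem_filter.2 ⟨(List.mem_ofFn' _ _).2 ⟨i, rfl⟩, decide_eq_true h0⟩

/-! ### Left inverses -/

theorem exists_leftInverse_iff (F : Matrix (Fin r) (Fin s) A) :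
    (∃ L : Matrix (Fin s) (Fin r) A, L * F = 1) ↔
      ∀ i : Fin s, Pi.single i 1 ∈ rowModule F := by
  have hrow : ∀ L : Matrix (Fin s) (Fin r) A, L * F = 1 ↔
      ∀ i, ∑ k, L i k • F k = Pi.single i 1 := by
    intro L
    rw [← Matrix.ext_iff]
    refine forall_congr' fun i => ?_
    rw [funext_iff]
    refine forall_congr' fun j => ?_
    simp [Matrix.mul_apply, Matrix.one_apply, Pi.single_apply, eq_comm]
  simp only [rowModule, Submodule.mem_span_range_iff_exists_fun, hrow]
  exact ⟨fun ⟨L, hL⟩ i => ⟨L i, hL i⟩, fun h => ⟨fun i => (h i).choose, fun i => (h i).choose_spec⟩⟩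

/-- A skew PBW extension of a left Noetherian ring is left Noetherian, hence satisfies the strong
rank condition, and a matrix with a left inverse has at least as many rows as columns. -/
theorem le_of_leftInverse [Nontrivial A] [LinearOrder (VMon n s)] (E : SkewPBW R n)
    (hE : E.IsBijective) (hord : IsMonomialOrder n s) (lgs : LeftGroebnerSoluble R)
    {F : Matrix (Fin r) (Fin s) A} {L : Matrix (Fin s) (Fin r) A} (h : L * F = 1) : s ≤ r := by
  rcases Nat.eq_zero_or_pos s with rfl | hs
  · exact Nat.zero_le r
  have := E.isNoetherian_vectors hE hord lgs
  have : IsNoetherianRing A :=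
    isNoetherian_of_injective (LinearMap.single A (fun _ : Fin s => A) ⟨0, hs⟩)
      (fun a b h => by simpa using congrFun h ⟨0, hs⟩)
  refine le_of_fin_injective A (Matrix.vecMulLinear L)
    (Function.LeftInverse.injective (g := Matrix.vecMulLinear F) fun v => ?_)
  rw [Matrix.vecMulLinear_apply, Matrix.vecMulLinear_apply, Matrix.vecMul_vecMul, h,
    Matrix.vecMul_one]

theorem leftInverseWith_spec [Nontrivial A] [DecidableEq A] [LinearOrder (VMon n s)]
    (E : SkewPBW R n) (hE : E.IsBijective) (hord : IsMonomialOrder n s)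
    (lgs : LeftGroebnerSoluble R) (F : Matrix (Fin r) (Fin s) A) (B : Tracked A r s)
    (hB : E.IsGroebnerBasis B.vecs (rowModule F)) (hH : B.G.transpose = B.H.transpose * F) :
    ∃ out ∈ E.leftInverseWith lgs (Part.some B),
      (r < s → out = none) ∧
      (out = none ↔ ∃ i : Fin s, Pi.single i 1 ∉ rowModule F) ∧
      (out = none ↔ ¬ ∃ L : Matrix (Fin s) (Fin r) A, L * F = 1) ∧
      ∀ L, out = some L → L * F = 1 ∧
        ∃ K : Matrix (Fin B.length) (Fin s) A,
          K.transpose * B.G.transpose = 1 ∧ L = K.transpose * B.H.transpose := by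
  have hiff : (∃ i : Fin s, Pi.single i 1 ∉ rowModule F) ↔
      ¬ ∃ L : Matrix (Fin s) (Fin r) A, L * F = 1 := by
    rw [exists_leftInverse_iff, not_forall]
  rw [← hiff, leftInverseWith]
  by_cases hrs : r < s
  · rw [if_pos hrs]
    refine ⟨none, Part.mem_some _, fun _ => rfl, ?_, ?_, fun L h => by simp at h⟩ <;>
    · simp only [true_iff]
      rw [hiff]
      rintro ⟨L, hL⟩
      exact absurd (E.le_of_leftInverse hE hord lgs hL) (not_le.2 hrs)
  · rw [if_neg hrs, Part.bind_some]
    choose d hd hsum hmem using fun i : Fin s => hB.divide_spec hE hord lgs (Pi.single i 1)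
    refine ⟨_, Part.mem_map _ (mem_runAll hd), fun h => absurd h hrs, ?_⟩
    by_cases hall : ∀ i, (d i).2 = 0
    · rw [if_pos hall]
      have hno : ¬ ∃ i : Fin s, Pi.single i 1 ∉ rowModule F := fun ⟨i, hi⟩ =>
        hi ((hmem i).1 (hall i))
      have hK : (Matrix.of fun i j => (d i).1 j : Matrix (Fin s) (Fin B.length) A) *
          B.G.transpose = 1 := by
        refine Matrix.ext fun i k => ?_
        have := congrFun (hsum i) k
        rw [hall i, add_zero] at this
        simp only [Matrix.mul_apply, Matrix.one_apply, Matrix.transpose_apply, Matrix.of_apply]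
        simp only [Finset.sum_apply, Pi.smul_apply, smul_eq_mul, Pi.single_apply] at this
        exact ((if_congr eq_comm rfl rfl).trans this).symm
      refine ⟨by simp [hno], by simp [hno], ?_⟩
      rintro L hL
      rw [Option.some.injEq] at hL
      refine ⟨?_, fun j i => (d i).1 j, hK, hL.symm⟩
      rw [← hL, Matrix.mul_assoc, ← hH]
      exact hK
    · rw [if_neg hall]
      have hyes : ∃ i : Fin s, Pi.single i 1 ∉ rowModule F := by
        obtain ⟨i, hi⟩ := not_forall.1 hall
        exact ⟨i, fun h => hi ((hmem i).2 h)⟩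
      exact ⟨by simp [hyes], by simp [hyes], fun L h => by simp at h⟩

end SkewPBW

theorem mainTheorem1 {A : Type*} [Ring A] [Nontrivial A] [DecidableEq A] {R : Subring A} {n : ℕ}
    (E : SkewPBW R n) (hE : E.IsBijective) (lgs : LeftGroebnerSoluble R)
    {r s : ℕ} [LinearOrder (VMon n s)] (hord : IsMonomialOrder n s)
    (F : Matrix (Fin r) (Fin s) A) :
    -- the algorithm is correct for every Gröbner basis `G` and every `H` with `Gᵀ = Hᵀ F`
    (∀ B : SkewPBW.Tracked A r s,
      E.IsGroebnerBasis B.vecs (SkewPBW.rowModule F) → B.G.transpose = B.H.transpose * F →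
      -- the division algorithm ends and is a membership test
      (∀ f : Fin s → A, ∃ d ∈ E.divide lgs B.vecs f,
        f = ∑ j, d.1 j • B.vecs j + d.2 ∧ (d.2 = 0 ↔ f ∈ SkewPBW.rowModule F)) ∧
      ∃ out ∈ E.leftInverseWith lgs (Part.some B),
        (r < s → out = none) ∧
        (out = none ↔ ∃ i : Fin s, Pi.single i 1 ∉ SkewPBW.rowModule F) ∧
        (out = none ↔ ¬ ∃ L : Matrix (Fin s) (Fin r) A, L * F = 1) ∧
        ∀ L, out = some L → L * F = 1 ∧
          ∃ K : Matrix (Fin B.length) (Fin s) A,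
            K.transpose * B.G.transpose = 1 ∧ L = K.transpose * B.H.transpose) ∧
    -- such `G` and `H` are computed by Buchberger's algorithm
    (∃ B ∈ E.buchberger lgs F,
      E.IsGroebnerBasis B.vecs (SkewPBW.rowModule F) ∧ B.G.transpose = B.H.transpose * F) ∧
    -- hence the whole algorithm ends and decides, with a left inverse in the positive case
    ∃ out ∈ E.leftInverse lgs F,
      (r < s → out = none) ∧
      (out = none ↔ ¬ ∃ L : Matrix (Fin s) (Fin r) A, L * F = 1) ∧
      ∀ L, out = some L → L * F = 1 := by
  obtain ⟨B, hB, hG, hH⟩ := E.buchberger_spec hE hord lgs F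
  refine ⟨fun B hB hH => ⟨fun f => hB.divide_spec hE hord lgs f,
    E.leftInverseWith_spec hE hord lgs F B hB hH⟩, ⟨B, hB, hG, hH⟩, ?_⟩
  obtain ⟨out, hout, h1, -, h2, h3⟩ := E.leftInverseWith_spec hE hord lgs F B hG hH
  refine ⟨out, ?_, h1, h2, fun L hL => (h3 L hL).1⟩
  rwa [SkewPBW.leftInverse, Part.eq_some_iff.2 hB]
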